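/- Let $k\ge 0$ be an integer and $\theta\in[-\pi,\pi]$. A $*$-probability space is a unital complex $*$-algebra $\mathcal A$ with a linear functional $\varphi$ satisfying $\varphi(1)=1$ and $\varphi(a^*a)\ge 0$ for all $a$. Write $\mathrm{Circ}(a_0,\dots,a_{n-1})$ for the $n\times n$ circulant matrix with $(i,j)$ entry $a_{(j-i)\bmod n}$, $0\le i,j\le n-1$, put $D_n(\theta)=\mathrm{diag}(1,e^{\iota\theta/n},\dots,e^{\iota\theta(n-1)/n})$, and for a random $n\times n$ matrix $M$ put $\varphi_n(M)=n^{-1}\mathbb E\,\mathrm{Tr}\,M$. Then there exist a $*$-probability space $(\mathcal A,\varphi)$ and elements $N_1,\dots,N_k,\tilde N_1,\dots,\tilde N_k,d(\theta)\in\mathcal A$ such that: (a) each $N_j$ and each $\tilde N_j$ is a standard complex Gaussian variable, i.e. $a\in\{N_j,\tilde N_j\}$ satisfies $aa^*=a^*a$ and $\varphi(a^pa^{*q})=\mathbb E(Z^p\bar Z^q)$ for all $p,q\ge0$, where $Z=X+\iota Y$ with $X,Y$ independent real Gaussian of mean $0$ and variance $1/2$; (b) the $2k$ variables $N_1,\dots,N_k,\tilde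 N_1,\dots,\tilde N_k$ are independent: any two distinct ones commute, each also commutes with the adjoint of the other, and $\varphi\big(\prod_r a_r^{p_r}a_r^{*q_r}\big)=\prod_r\varphi(a_r^{p_r}a_r^{*q_r})$ for any distinct $a_1,a_2,\dots$ among them and all exponents $p_r,q_r\ge0$; (c) $d(\theta)$ is unitary and has the $*$-moments of $e^{\iota\theta U}$ with $U\sim\mathrm{Uniform}(0,1)$; (d) the following convergence holds. Let $\tau\in[-\pi,\pi]$, and let $c^{(j)}_i,\tilde c^{(j)}_i$ ($1\le j\le k$, $i\ge0$) be any real random variables on a common probability space that are all independent, have mean zero and variance one, and satisfy, for each $p\in\mathbb N$, $\sup_{i,j}\max\{\mathbb E|c^{(j)}_i|^p,\mathbb E|\tilde c^{(j)}_i|^p\}<\infty$ (Assumption I). With $\eta=e^{\iota\tau/n}$ let $$C_n^{(j)}=\mathrm{Circ}(c^{(j)}_0,\dots,c^{(j)}_{n-1}),\qquad \tilde C_n^{(j)}=\mathrm{Circ}(\tilde c^{(j)}_0,\tilde c^{(j)}_1\eta,\dots,\tilde c^{(j)}_{n-1}\eta^{n-1}).$$ Then $\{n^{-1/2}C_n^{(j)},n^{-1/2}\tilde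 C_n^{(j)},D_n(\theta)\}_{1\le j\le k}$ converge jointly in $*$-distribution to $\{N_j,\tilde N_j,d(\theta)\}_{1\le j\le k}$: for every monomial $Q$ in $2k+1$ non-commuting indeterminates and their adjoints, $$\lim_{n\to\infty}\varphi_n\big(Q(n^{-1/2}C_n^{(j)},n^{-1/2}\tilde C_n^{(j)},D_n(\theta))\big)=\varphi\big(Q(N_j,\tilde N_j,d(\theta))\big).$$ In particular the twist $\tau=\pi$, that is $\eta=e^{\iota\pi/n}$, is included, and so is $\tau=\theta$. -/

import Mathlib

open MeasureTheory ProbabilityTheory Filter Topology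

/-- A non-commutative `*`-probability space: a unital complex `*`-algebra with a state, that is a
linear functional which is unital and positive. -/
structure StarProbSpace where
  carrier : Type
  [ring : Ring carrier]
  [starRing : StarRing carrier]
  [algebra : Algebra ℂ carrier]
  [starModule : StarModule ℂ carrier]
  state : carrier →ₗ[ℂ] ℂ
  state_one : state 1 = 1
  state_nonneg : ∀ a : carrier,
    0 ≤ (state (star a * a)).re ∧ (state (star a * a)).im = 0

attribute [instance] StarProbSpace.ring StarProbSpace.starRing StarProbSpace.algebra
  StarProbSpace.starModule

/-- Evaluation of a monomial in the non-commuting indeterminates `x_i, x_i^*` at a family `a`.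
The monomial is a word; the letter `(i, false)` stands for `x_i` and `(i, true)` for `x_i^*`. -/
def starWord {ι A : Type*} [Monoid A] [Star A] (a : ι → A) (w : List (ι × Bool)) : A :=
  (w.map fun x => if x.2 then star (a x.1) else a x.1).prod

/-- Joint convergence in `*`-distribution of `(a n i)_i` (with respect to the functional `φn n`) to
`(b i)_i` (with respect to `φ`): all joint `*`-moments converge. -/
def ConvergesInStarDistribution {ι : Type*} {B : ℕ → Type*} [∀ n, Monoid (B n)] [∀ n, Star (B n)]
    {A : Type*} [Monoid A] [Star A] (φn : ∀ n, B n → ℂ) (a : ∀ n, ι → B n)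
    (φ : A → ℂ) (b : ι → A) : Prop :=
  ∀ w : List (ι × Bool),
    Tendsto (fun n => φn n (starWord (a n) w)) atTop (𝓝 (φ (starWord b w)))

/-- The variable `a` is normal and its `*`-moments are those of the probability measure `μ`. -/
def HasStarLaw {A : Type*} [Monoid A] [Star A] (φ : A → ℂ) (a : A) (μ : Measure ℂ) : Prop :=
  Commute a (star a) ∧
    ∀ p q : ℕ, φ (a ^ p * star a ^ q) = ∫ z, z ^ p * star z ^ q ∂μ

/-- Independence of a family of variables: distinct variables commute with each other and with each
other's adjoints, and the joint `*`-moments factorize. -/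
def IndepVariables {ι A : Type*} [Monoid A] [Star A] (φ : A → ℂ) (a : ι → A) : Prop :=
  (∀ i j, i ≠ j → Commute (a i) (a j) ∧ Commute (a i) (star (a j))) ∧
    ∀ (p q : ι → ℕ) (l : List ι), l.Nodup →
      φ (l.map fun i => a i ^ p i * star (a i) ^ q i).prod =
        (l.map fun i => φ (a i ^ p i * star (a i) ^ q i)).prod

/-- The standard complex Gaussian law: the law of `X + iY` with `X, Y` independent centred real
Gaussian variables of variance `1/2`. -/
noncomputable def stdComplexGaussian : Measure ℂ :=
  ((gaussianReal 0 (1 / 2)).prod (gaussianReal 0 (1 / 2))).map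
    fun x => (x.1 : ℂ) + (x.2 : ℂ) * Complex.I

/-- The law of `e^{iθU}` with `U` uniformly distributed on `(0, 1)`. -/
noncomputable def expUniformLaw (θ : ℝ) : Measure ℂ :=
  (volume.restrict (Set.Ioo (0 : ℝ) 1)).map fun u : ℝ => Complex.exp (Complex.I * θ * u)

/-- The random variables `X i` are independent, centred, of unit variance, and their moments of each
order are bounded uniformly in `i`. -/
structure AssumptionI {ι Ω : Type*} [MeasurableSpace Ω] (P : Measure Ω) (X : ι → Ω → ℝ) : Prop where
  measurable : ∀ i, Measurable (X i)
  indep : iIndepFun X P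
  mean_zero : ∀ i, ∫ ω, X i ω ∂P = 0
  unit_variance : ∀ i, variance (X i) P = 1
  bounded_moments : ∀ p : ℕ, ∃ K : ℝ, ∀ i,
    Integrable (fun ω => |X i ω| ^ p) P ∧ ∫ ω, |X i ω| ^ p ∂P ≤ K

/-- The `n × n` circulant matrix `Circ(c_0, …, c_{n-1})`, whose `(i, j)` entry is
`c_{(j - i) mod n}`. -/
def circ (n : ℕ) (c : ℕ → ℂ) : Matrix (Fin n) (Fin n) ℂ :=
  Matrix.of fun i j => c (((j : ℕ) + n - (i : ℕ)) % n)

/-- `η = e^{iτ/n}`. -/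
noncomputable def eta (τ : ℝ) (n : ℕ) : ℂ := Complex.exp (Complex.I * τ / n)

/-- `D_n(θ) = diag(1, η, …, η^{n-1})` with `η = e^{iθ/n}`. -/
noncomputable def diagD (θ : ℝ) (n : ℕ) : Matrix (Fin n) (Fin n) ℂ :=
  Matrix.diagonal fun j => eta θ n ^ (j : ℕ)

/-- The random circulant `n^{-1/2} Circ(c_0, …, c_{n-1})`. -/
noncomputable def scaledCirc {Ω : Type*} (c : ℕ → Ω → ℝ) (n : ℕ) :
    Ω → Matrix (Fin n) (Fin n) ℂ :=
  fun ω => ((Real.sqrt n : ℝ) : ℂ)⁻¹ • circ n fun i => (c i ω : ℂ)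

/-- The random twisted circulant `n^{-1/2} Circ(c_0, c_1 η, …, c_{n-1} η^{n-1})` with
`η = e^{iτ/n}`. -/
noncomputable def scaledTwistedCirc {Ω : Type*} (τ : ℝ) (c : ℕ → Ω → ℝ) (n : ℕ) :
    Ω → Matrix (Fin n) (Fin n) ℂ :=
  fun ω => ((Real.sqrt n : ℝ) : ℂ)⁻¹ • circ n fun i => (c i ω : ℂ) * eta τ n ^ i

/-- `φ_n = n^{-1} 𝔼 Tr` on random `n × n` matrices. -/
noncomputable def expectedTrace {Ω : Type*} [MeasurableSpace Ω] (P : Measure Ω) (n : ℕ)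
    (M : Ω → Matrix (Fin n) (Fin n) ℂ) : ℂ :=
  (n : ℂ)⁻¹ * ∫ ω, (M ω).trace ∂P

section MomentFunctional

variable {σ ι : Type*}

/-- The linear functional on polynomials under which the variables are independent with moments
`mom`. -/
noncomputable def momentFunctional (mom : σ → ℕ → ℂ) : MvPolynomial σ ℂ →ₗ[ℂ] ℂ :=
  (MvPolynomial.basisMonomials σ ℂ).constr ℂ fun m => m.prod mom

/-- The moment sequences are normalised, centred, of unit variance, and bounded by `K`. -/
structure NormalizedMoments (K : ℕ → ℝ) (mom : σ → ℕ → ℂ) : Prop where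
  zero : ∀ x, mom x 0 = 1
  one : ∀ x, mom x 1 = 0
  two : ∀ x, mom x 2 = 1
  bound : ∀ x j k, j ≤ k → ‖mom x j‖ ≤ K k

lemma momentFunctional_monomial (mom : σ → ℕ → ℂ) (m : σ →₀ ℕ) (c : ℂ) :
    momentFunctional mom (MvPolynomial.monomial m c) = c * m.prod mom := by
  have h := (MvPolynomial.basisMonomials σ ℂ).constr_basis ℂ (fun m => m.prod mom) m
  rw [MvPolynomial.coe_basisMonomials] at h
  have h2 : MvPolynomial.monomial m c = c • MvPolynomial.monomial m (1 : ℂ) := by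
    rw [MvPolynomial.smul_monomial]; simp
  rw [h2, map_smul, momentFunctional, h, smul_eq_mul]

lemma momentFunctional_one (mom : σ → ℕ → ℂ) : momentFunctional mom 1 = 1 := by
  have := momentFunctional_monomial mom 0 1
  simpa using this

lemma momentFunctional_eq_sum (mom : σ → ℕ → ℂ) (p : MvPolynomial σ ℂ) :
    momentFunctional mom p = ∑ m ∈ p.support, p.coeff m * m.prod mom := by
  conv_lhs => rw [p.as_sum]
  rw [map_sum]
  exact Finset.sum_congr rfl fun m _ => momentFunctional_monomial _ _ _

lemma momentFunctional_X_pow_mul {K : ℕ → ℝ} {mom : σ → ℕ → ℂ} (hm : NormalizedMoments K mom)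
    (x : σ) (k : ℕ) {q : MvPolynomial σ ℂ} (hq : q ∈ MvPolynomial.supported ℂ {x}ᶜ) :
    momentFunctional mom (MvPolynomial.X x ^ k * q) = mom x k * momentFunctional mom q := by
  classical
  rw [MvPolynomial.mem_supported] at hq
  conv_lhs => rw [q.as_sum]
  rw [Finset.mul_sum, map_sum, momentFunctional_eq_sum, Finset.mul_sum]
  refine Finset.sum_congr rfl fun m hmem => ?_
  rw [MvPolynomial.X_pow_eq_monomial, MvPolynomial.monomial_mul, momentFunctional_monomial]
  have hx : x ∉ m.support := fun h =>
    hq (Finset.mem_coe.2 ((MvPolynomial.mem_vars_iff_mem_support x).2 ⟨m, hmem, h⟩)) rfl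
  rw [Finsupp.prod_add_index_of_disjoint, Finsupp.prod_single_index (hm.zero x)]
  · ring
  · refine Finset.disjoint_of_subset_left Finsupp.support_single_subset ?_
    simpa using hx

/-- The linear form `∑ x ∈ s, a x • X x`. -/
noncomputable def linForm (s : Finset σ) (a : σ → ℂ) : MvPolynomial σ ℂ :=
  ∑ x ∈ s, MvPolynomial.C (a x) * MvPolynomial.X x

lemma linForm_erase [DecidableEq σ] {s : Finset σ} (a : σ → ℂ) {x : σ} (hx : x ∈ s) :
    linForm s a = MvPolynomial.C (a x) * MvPolynomial.X x + linForm (s.erase x) a :=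
  (Finset.add_sum_erase s _ hx).symm

lemma linForm_erase_mem_supported [DecidableEq σ] (s : Finset σ) (a : σ → ℂ) (x : σ) :
    linForm (s.erase x) a ∈ MvPolynomial.supported ℂ ({x}ᶜ : Set σ) := by
  refine Subalgebra.sum_mem _ fun y hy => Subalgebra.mul_mem _ ?_ ?_
  · exact Subalgebra.algebraMap_mem _ (a y)
  · exact MvPolynomial.X_mem_supported.2 (by simpa using (Finset.mem_erase.1 hy).1)

lemma momentFunctional_X_pow_mul_prod_linForm [DecidableEq σ] [DecidableEq ι] {K : ℕ → ℝ}
    {mom : σ → ℕ → ℂ}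
    (hm : NormalizedMoments K mom) {s : Finset σ} (α : ι → σ → ℂ) {x : σ} (hx : x ∈ s) (k : ℕ)
    (S : Finset ι) :
    momentFunctional mom (MvPolynomial.X x ^ k * ∏ l ∈ S, linForm s (α l)) =
      ∑ T ∈ S.powerset, (∏ l ∈ T, α l x) * mom x (k + T.card) *
        momentFunctional mom (∏ l ∈ S \ T, linForm (s.erase x) (α l)) := by
  have h : ∏ l ∈ S, linForm s (α l) = ∑ T ∈ S.powerset, (∏ l ∈ T, MvPolynomial.C (α l x) *
      MvPolynomial.X x) * ∏ l ∈ S \ T, linForm (s.erase x) (α l) := by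
    rw [← Finset.prod_add]
    exact Finset.prod_congr rfl fun l _ => linForm_erase _ hx
  rw [h, Finset.mul_sum, map_sum]
  refine Finset.sum_congr rfl fun T _ => ?_
  rw [Finset.prod_mul_distrib, Finset.prod_const, ← map_prod]
  have h2 : MvPolynomial.X x ^ k * (MvPolynomial.C (∏ l ∈ T, α l x) * MvPolynomial.X x ^ T.card *
      ∏ l ∈ S \ T, linForm (s.erase x) (α l)) = (∏ l ∈ T, α l x) • (MvPolynomial.X x ^ (k + T.card)
        * ∏ l ∈ S \ T, linForm (s.erase x) (α l)) := by
    rw [MvPolynomial.smul_eq_C_mul]; ring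
  rw [h2, map_smul, momentFunctional_X_pow_mul hm, smul_eq_mul, mul_assoc]
  exact Subalgebra.prod_mem _ fun l _ => linForm_erase_mem_supported _ _ _

lemma momentFunctional_linForm_mul {mom : σ → ℕ → ℂ}
    (s : Finset σ) (a : σ → ℂ) (q : MvPolynomial σ ℂ) :
    momentFunctional mom (linForm s a * q) =
      ∑ x ∈ s, a x * momentFunctional mom (MvPolynomial.X x * q) := by
  rw [linForm, Finset.sum_mul, map_sum]
  refine Finset.sum_congr rfl fun x _ => ?_
  rw [mul_assoc, ← MvPolynomial.smul_eq_C_mul, map_smul, smul_eq_mul]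

lemma norm_prod_le_pow {T : Finset ι} {f : ι → ℂ} {a : ℝ} (h : ∀ l, ‖f l‖ ≤ a) :
    ‖∏ l ∈ T, f l‖ ≤ a ^ T.card := by
  rw [norm_prod, ← Finset.prod_const]
  exact Finset.prod_le_prod (fun _ _ => norm_nonneg _) fun l _ => h l

/-- Joint moments of linear forms with coefficients of size `a` in `O(a⁻²)` independent variables
are bounded. -/
lemma exists_momentFunctional_prod_linForm_bound (K : ℕ → ℝ) (κ : ℝ) (m : ℕ) :
    ∃ B : ℝ, 0 ≤ B ∧ ∀ {σ ι : Type} (mom : σ → ℕ → ℂ), NormalizedMoments K mom →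
      ∀ (s : Finset σ) (α : ι → σ → ℂ) (a : ℝ), 0 ≤ a → a ≤ 1 → s.card * a ^ 2 ≤ κ →
        (∀ l x, ‖α l x‖ ≤ a) → ∀ S : Finset ι, S.card ≤ m →
          ‖momentFunctional mom (∏ l ∈ S, linForm s (α l))‖ ≤ B := by
  classical
  induction m with
  | zero =>
    refine ⟨1, zero_le_one, ?_⟩
    intro σ ι mom hm s α a _ _ _ _ S hS
    have : S = ∅ := by simpa using hS
    simp [this, momentFunctional_one]
  | succ m ih =>
    obtain ⟨B, hB0, hB⟩ := ih
    refine ⟨max 1 (|κ| * (2 ^ m * (|K (m + 1)| * B))), le_trans zero_le_one (le_max_left _ _), ?_⟩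
    intro σ ι mom hm s α a ha0 ha1 hs hα S hS
    rcases S.eq_empty_or_nonempty with rfl | ⟨l0, hl0⟩
    · simp [momentFunctional_one]
    refine le_trans ?_ (le_max_right _ _)
    rw [← Finset.mul_prod_erase S _ hl0, momentFunctional_linForm_mul]
    have hc : (S.erase l0).card ≤ m := by rw [Finset.card_erase_of_mem hl0]; omega
    set S' := S.erase l0
    have hterm : ∀ x ∈ s, ‖α l0 x * momentFunctional mom (MvPolynomial.X x *
        ∏ l ∈ S', linForm s (α l))‖ ≤ a ^ 2 * (2 ^ m * (|K (m + 1)| * B)) := by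
      intro x hx
      have h1 := momentFunctional_X_pow_mul_prod_linForm hm α hx 1 S'
      rw [pow_one] at h1
      rw [h1, norm_mul]
      have : ‖∑ T ∈ S'.powerset, (∏ l ∈ T, α l x) * mom x (1 + T.card) *
          momentFunctional mom (∏ l ∈ S' \ T, linForm (s.erase x) (α l))‖ ≤
          ∑ T ∈ S'.powerset, a * (|K (m + 1)| * B) := by
        refine norm_sum_le_of_le _ fun T hT => ?_
        have hTS := Finset.mem_powerset.1 hT
        rcases T.eq_empty_or_nonempty with rfl | hne
        · simp only [Finset.card_empty, add_zero, hm.one, mul_zero, zero_mul, norm_zero]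
          positivity
        have hT1 : 1 ≤ T.card := hne.card_pos
        have hTm := Finset.card_le_card hTS
        rw [norm_mul, norm_mul, mul_assoc]
        refine mul_le_mul ?_ (mul_le_mul ?_ ?_ (norm_nonneg _) (abs_nonneg _)) (by positivity) ha0
        · refine (norm_prod_le_pow fun l => hα l x).trans ?_
          simpa using pow_le_pow_of_le_one ha0 ha1 hT1
        · exact (hm.bound x _ (m + 1) (by omega)).trans (le_abs_self _)
        · refine hB mom hm (s.erase x) α a ha0 ha1 (le_trans ?_ hs) hα _
            ((Finset.card_le_card Finset.sdiff_subset).trans hc)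
          gcongr
          exact Finset.erase_subset _ _
      rw [Finset.sum_const, Finset.card_powerset, nsmul_eq_mul] at this
      push_cast at this
      calc _ ≤ a * (2 ^ S'.card * (a * (|K (m + 1)| * B))) :=
            mul_le_mul (hα _ _) this (norm_nonneg _) ha0
        _ ≤ a * (2 ^ m * (a * (|K (m + 1)| * B))) := by gcongr; norm_num
        _ = _ := by ring
    refine (norm_sum_le_of_le _ hterm).trans ?_
    rw [Finset.sum_const, nsmul_eq_mul, ← mul_assoc]
    gcongr
    exact hs.trans (le_abs_self _)

/-- Approximate Wick recursion for joint moments of linear forms. -/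
lemma exists_momentFunctional_wick_bound (K : ℕ → ℝ) (κ : ℝ) (m : ℕ) :
    ∃ B : ℝ, 0 ≤ B ∧ ∀ {σ ι : Type} [DecidableEq ι] (mom : σ → ℕ → ℂ), NormalizedMoments K mom →
      ∀ (s : Finset σ) (α : ι → σ → ℂ) (a : ℝ), 0 ≤ a → a ≤ 1 → s.card * a ^ 2 ≤ κ →
        (∀ l x, ‖α l x‖ ≤ a) → ∀ (S : Finset ι) (l₀ : ι), S.card ≤ m →
          ‖momentFunctional mom (linForm s (α l₀) * ∏ l ∈ S, linForm s (α l)) -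
            ∑ l ∈ S, (∑ x ∈ s, α l₀ x * α l x) *
              momentFunctional mom (∏ l ∈ S.erase l, linForm s (α l))‖ ≤ B * a := by
  classical
  obtain ⟨B, hB0, hB⟩ := exists_momentFunctional_prod_linForm_bound K κ m
  set D := 2 ^ m * (|K (m + 1)| * B) with hD
  have hD0 : 0 ≤ D := by positivity
  refine ⟨|κ| * (D + m * D), by positivity, ?_⟩
  intro σ ι inst mom hm s α a ha0 ha1 hs hα S l₀ hS
  have hinst : inst = fun a b => Classical.propDecidable (a = b) := Subsingleton.elim _ _
  subst hinst
  have hserase : ∀ x, ((s.erase x).card : ℝ) * a ^ 2 ≤ κ := fun x => by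
    refine le_trans ?_ hs
    gcongr
    exact Finset.erase_subset _ _
  have hsum : ∀ (x : σ) (S : Finset ι) (F : Finset (Finset ι)) (j r : ℕ), S.card ≤ m →
      F ⊆ S.powerset → j ≤ 1 → (∀ T ∈ F, r ≤ T.card) →
      ‖∑ T ∈ F, (∏ l ∈ T, α l x) * mom x (j + T.card) *
          momentFunctional mom (∏ l ∈ S \ T, linForm (s.erase x) (α l))‖ ≤ a ^ r * D := by
    intro x S F j r hS hF hj hr
    have h1 : ‖∑ T ∈ F, (∏ l ∈ T, α l x) * mom x (j + T.card) *
          momentFunctional mom (∏ l ∈ S \ T, linForm (s.erase x) (α l))‖ ≤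
        ∑ T ∈ F, a ^ r * (|K (m + 1)| * B) := by
      refine norm_sum_le_of_le _ fun T hT => ?_
      have hTm := Finset.card_le_card (Finset.mem_powerset.1 (hF hT))
      rw [norm_mul, norm_mul, mul_assoc]
      refine mul_le_mul ?_ (mul_le_mul ?_ ?_ (norm_nonneg _) (abs_nonneg _)) (by positivity)
        (by positivity)
      · exact (norm_prod_le_pow fun l => hα l x).trans (pow_le_pow_of_le_one ha0 ha1 (hr T hT))
      · exact (hm.bound x _ (m + 1) (by omega)).trans (le_abs_self _)
      · exact hB mom hm (s.erase x) α a ha0 ha1 (hserase x) hα _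
          ((Finset.card_le_card Finset.sdiff_subset).trans hS)
    refine h1.trans ?_
    rw [Finset.sum_const, nsmul_eq_mul]
    have h2 : (F.card : ℝ) ≤ 2 ^ m := by
      have := Finset.card_le_card hF
      rw [Finset.card_powerset] at this
      exact_mod_cast this.trans (Nat.pow_le_pow_right (by norm_num) hS)
    calc _ ≤ 2 ^ m * (a ^ r * (|K (m + 1)| * B)) := by gcongr
      _ = _ := by rw [hD]; ring
  have hterm : ∀ x ∈ s, ‖α l₀ x * momentFunctional mom (MvPolynomial.X x *
        ∏ l ∈ S, linForm s (α l)) - ∑ l ∈ S, α l₀ x * α l x *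
              momentFunctional mom (∏ l ∈ S.erase l, linForm s (α l))‖ ≤
      a ^ 3 * (D + m * D) := by
    intro x hx
    have h1 := momentFunctional_X_pow_mul_prod_linForm hm α hx 1 S
    rw [pow_one, ← Finset.sum_filter_add_sum_filter_not _ (fun T => T.card = 1)] at h1
    have hP : S.powerset.filter (fun T => T.card = 1) = S.image fun l => {l} := by
      ext T
      simp only [Finset.mem_filter, Finset.mem_powerset, Finset.mem_image, Finset.card_eq_one]
      constructor
      · rintro ⟨h, l, rfl⟩
        exact ⟨l, by simpa using h, rfl⟩
      · rintro ⟨l, hl, rfl⟩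
        exact ⟨by simpa using hl, l, rfl⟩
    rw [hP, Finset.sum_image (fun _ _ _ _ h => Finset.singleton_injective h)] at h1
    have hrest : ‖∑ T ∈ S.powerset.filter (fun T => ¬ T.card = 1), (∏ l ∈ T, α l x) *
        mom x (1 + T.card) * momentFunctional mom (∏ l ∈ S \ T, linForm (s.erase x) (α l))‖ ≤
        a ^ 2 * D := by
      rw [← Finset.sum_filter_of_ne (p := fun T => T ≠ ∅)]
      · refine hsum x S _ 1 2 hS ?_ le_rfl ?_
        · exact (Finset.filter_subset _ _).trans (Finset.filter_subset _ _)
        · intro T hT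
          simp only [Finset.mem_filter] at hT
          have := Finset.card_pos.2 (Finset.nonempty_iff_ne_empty.2 hT.2)
          omega
      · rintro T - hne rfl
        simp [hm.one] at hne
    have hdiff : ∀ l ∈ S, ‖momentFunctional mom (∏ l ∈ S \ {l}, linForm (s.erase x) (α l)) -
        momentFunctional mom (∏ l ∈ S.erase l, linForm s (α l))‖ ≤ a * D := by
      intro l hl
      have h2 := momentFunctional_X_pow_mul_prod_linForm hm α hx 0 (S.erase l)
      rw [pow_zero, one_mul, ← Finset.add_sum_erase _ _ (Finset.empty_mem_powerset _)] at h2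
      simp only [Finset.prod_empty, Finset.card_empty, hm.zero, Finset.sdiff_empty, add_zero,
        one_mul] at h2
      rw [h2, Finset.sdiff_singleton_eq_erase, sub_add_cancel_left, norm_neg]
      have := hsum x (S.erase l) ((S.erase l).powerset.erase ∅) 0 1
        ((Finset.card_le_card (Finset.erase_subset _ _)).trans hS) (Finset.erase_subset _ _)
        (by norm_num) fun T hT => Finset.card_pos.2
          (Finset.nonempty_iff_ne_empty.2 (Finset.ne_of_mem_erase hT))
      simpa using this
    have h3 : α l₀ x * momentFunctional mom (MvPolynomial.X x *
        ∏ l ∈ S, linForm s (α l)) - ∑ l ∈ S, α l₀ x * α l x *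
              momentFunctional mom (∏ l ∈ S.erase l, linForm s (α l)) =
        α l₀ x * (∑ T ∈ S.powerset.filter (fun T => ¬ T.card = 1), (∏ l ∈ T, α l x) *
        mom x (1 + T.card) * momentFunctional mom (∏ l ∈ S \ T, linForm (s.erase x) (α l))) +
        ∑ l ∈ S, α l₀ x * α l x * (momentFunctional mom (∏ l ∈ S \ {l}, linForm (s.erase x) (α l)) -
        momentFunctional mom (∏ l ∈ S.erase l, linForm s (α l))) := by
      rw [h1, mul_add, Finset.mul_sum]
      simp only [Finset.prod_singleton, Finset.card_singleton, Nat.reduceAdd, hm.two, mul_sub,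
        Finset.sum_sub_distrib, mul_one, mul_assoc]
      ring
    rw [h3]
    have h4 : ‖∑ l ∈ S, α l₀ x * α l x * (momentFunctional mom
        (∏ l ∈ S \ {l}, linForm (s.erase x) (α l)) -
        momentFunctional mom (∏ l ∈ S.erase l, linForm s (α l)))‖ ≤ ∑ l ∈ S, a * a * (a * D) := by
      refine norm_sum_le_of_le _ fun l hl => ?_
      rw [norm_mul, norm_mul]
      exact mul_le_mul (mul_le_mul (hα _ _) (hα _ _) (norm_nonneg _) ha0) (hdiff l hl)
        (norm_nonneg _) (by positivity)
    rw [Finset.sum_const, nsmul_eq_mul] at h4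
    refine (norm_add_le _ _).trans ?_
    rw [norm_mul]
    calc _ ≤ a * (a ^ 2 * D) + S.card * (a * a * (a * D)) :=
          add_le_add (mul_le_mul (hα _ _) hrest (norm_nonneg _) ha0) h4
      _ ≤ a * (a ^ 2 * D) + m * (a * a * (a * D)) := by gcongr
      _ = _ := by ring
  have hfin : momentFunctional mom (linForm s (α l₀) * ∏ l ∈ S, linForm s (α l)) -
            ∑ l ∈ S, (∑ x ∈ s, α l₀ x * α l x) *
              momentFunctional mom (∏ l ∈ S.erase l, linForm s (α l)) =
      ∑ x ∈ s, (α l₀ x * momentFunctional mom (MvPolynomial.X x *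
        ∏ l ∈ S, linForm s (α l)) - ∑ l ∈ S, α l₀ x * α l x *
              momentFunctional mom (∏ l ∈ S.erase l, linForm s (α l))) := by
    rw [momentFunctional_linForm_mul, Finset.sum_sub_distrib, Finset.sum_comm]
    simp only [Finset.sum_mul]
  rw [hfin]
  refine (norm_sum_le_of_le _ hterm).trans ?_
  rw [Finset.sum_const, nsmul_eq_mul]
  calc _ = (s.card * a ^ 2) * (a * (D + m * D)) := by ring
    _ ≤ |κ| * (a * (D + m * D)) := by
        gcongr
        exact hs.trans (le_abs_self _)
    _ = _ := by ring

end MomentFunctional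

section WickCount

variable {Λ ι : Type*} [DecidableEq Λ]

/-- `E Z^p Z̄^q` for a standard complex Gaussian `Z`, with `p = c false` and `q = c true`. -/
def gaussMoment (c : Bool → ℕ) : ℕ := if c false = c true then (c false).factorial else 0

/-- The number of positions of `S` that carry the label `(k, b)`. -/
def labelCount (lab : ι → Λ × Bool) (S : Finset ι) (k : Λ) (b : Bool) : ℕ :=
  (S.filter fun l => lab l = (k, b)).card

/-- The joint moment of independent standard complex Gaussian variables indexed by `Λ`, along the
positions of `S`. -/
def wickCount (lab : ι → Λ × Bool) (S : Finset ι) : ℕ :=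
  ∏ k ∈ S.image fun l => (lab l).1, gaussMoment (labelCount lab S k)

lemma wickCount_eq_prod (lab : ι → Λ × Bool) {S : Finset ι} {U : Finset Λ}
    (h : ∀ l ∈ S, (lab l).1 ∈ U) : wickCount lab S = ∏ k ∈ U, gaussMoment (labelCount lab S k) := by
  refine Finset.prod_subset (fun k hk => ?_) fun k _ hk => ?_
  · obtain ⟨l, hl, rfl⟩ := Finset.mem_image.1 hk
    exact h l hl
  · have : ∀ b, labelCount lab S k b = 0 := fun b => by
      rw [labelCount, Finset.card_eq_zero, Finset.filter_eq_empty_iff]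
      intro l hl hlk
      exact hk (Finset.mem_image.2 ⟨l, hl, by rw [hlk]⟩)
    simp [gaussMoment, this]

lemma gaussMoment_add_single (c c' : Bool → ℕ) (b : Bool) (h1 : c' b = c b + 1)
    (h2 : c' (!b) = c (!b)) (d : Bool → ℕ) (h3 : d b = c b) (h4 : d (!b) = c (!b) - 1) :
    gaussMoment c' = c (!b) * gaussMoment d := by
  unfold gaussMoment
  cases b
  · simp only [Bool.not_false] at *
    rw [h1, h2, h3, h4]
    rcases Nat.eq_zero_or_pos (c true) with h | h
    · simp [h]
    · by_cases h5 : c false + 1 = c true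
      · rw [if_pos h5, if_pos (by omega), ← h5, Nat.factorial_succ]
      · rw [if_neg h5, if_neg (by omega), mul_zero]
  · simp only [Bool.not_true] at *
    rw [h1, h2, h3, h4]
    rcases Nat.eq_zero_or_pos (c false) with h | h
    · simp [h]
    · by_cases h5 : c false = c true + 1
      · rw [if_pos h5, if_pos (by omega), h5, Nat.factorial_succ]; rfl
      · rw [if_neg h5, if_neg (by omega), mul_zero]

lemma wickCount_insert [DecidableEq ι] (lab : ι → Λ × Bool) {S : Finset ι} {l₀ : ι} (h₀ : l₀ ∉ S) :
    wickCount lab (insert l₀ S) = ∑ l ∈ S,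
      if (lab l₀).1 = (lab l).1 ∧ (lab l₀).2 ≠ (lab l).2 then wickCount lab (S.erase l) else 0 := by
  set k₀ := (lab l₀).1 with hk₀
  set b₀ := (lab l₀).2 with hb₀
  set U := insert k₀ (S.image fun l => (lab l).1) with hU
  have hk₀U : k₀ ∈ U := Finset.mem_insert_self _ _
  have hSU : ∀ l ∈ S, (lab l).1 ∈ U := fun l hl =>
    Finset.mem_insert_of_mem (Finset.mem_image_of_mem (fun l => (lab l).1) hl)
  have hIU : ∀ l ∈ insert l₀ S, (lab l).1 ∈ U := by
    intro l hl
    rcases Finset.mem_insert.1 hl with rfl | hl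
    · exact hk₀U
    · exact hSU l hl
  have hcond : ∀ l, (k₀ = (lab l).1 ∧ b₀ ≠ (lab l).2) ↔ lab l = (k₀, !b₀) := by
    intro l
    rw [Prod.ext_iff, hk₀, hb₀]
    constructor
    · rintro ⟨h1, h2⟩
      refine ⟨h1.symm, ?_⟩
      cases h : (lab l).2 <;> cases h' : (lab l₀).2 <;> simp_all
    · rintro ⟨h1, h2⟩
      refine ⟨h1.symm, ?_⟩
      rw [h2]; cases (lab l₀).2 <;> simp
  have hcount : ∀ k b, labelCount lab (insert l₀ S) k b =
      labelCount lab S k b + if (k, b) = (k₀, b₀) then 1 else 0 := by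
    intro k b
    unfold labelCount
    rw [Finset.filter_insert]
    by_cases h : lab l₀ = (k, b)
    · have h' : (k, b) = (k₀, b₀) := h.symm
      rw [if_pos h, if_pos h', Finset.card_insert_of_notMem]
      simp [h₀]
    · have h' : ¬ (k, b) = (k₀, b₀) := fun h2 => h h2.symm
      rw [if_neg h, if_neg h', add_zero]
  have herase : ∀ l ∈ S, lab l = (k₀, !b₀) → ∀ k b, labelCount lab (S.erase l) k b =
      labelCount lab S k b - if (k, b) = (k₀, !b₀) then 1 else 0 := by
    intro l hl hlab k b
    unfold labelCount
    rw [Finset.filter_erase]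
    by_cases h : (k, b) = (k₀, !b₀)
    · rw [if_pos h, Finset.card_erase_of_mem]
      simp [hl, hlab, h]
    · rw [if_neg h, Finset.erase_eq_of_notMem]
      · simp
      · simp only [Finset.mem_filter, not_and]
        exact fun _ h2 => h (h2.symm.trans hlab)
  set R := ∏ k ∈ U.erase k₀, gaussMoment (labelCount lab S k) with hR
  set d : Bool → ℕ := fun b => labelCount lab S k₀ b - if b = !b₀ then 1 else 0 with hd
  have h1 : wickCount lab (insert l₀ S) = gaussMoment (labelCount lab (insert l₀ S) k₀) * R := by
    rw [wickCount_eq_prod lab hIU, ← Finset.mul_prod_erase _ _ hk₀U, hR]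
    congr 1
    refine Finset.prod_congr rfl fun k hk => ?_
    congr 1
    funext b
    rw [hcount, if_neg, add_zero]
    intro h
    exact Finset.ne_of_mem_erase hk (Prod.ext_iff.1 h).1
  have h2 : ∀ l ∈ S, lab l = (k₀, !b₀) → wickCount lab (S.erase l) = gaussMoment d * R := by
    intro l hl hlab
    rw [wickCount_eq_prod lab (fun l' hl' => hSU l' (Finset.mem_of_mem_erase hl')),
      ← Finset.mul_prod_erase _ _ hk₀U, hR]
    congr 1
    · congr 1
      funext b
      rw [herase l hl hlab, hd]
      simp
    · refine Finset.prod_congr rfl fun k hk => ?_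
      congr 1
      funext b
      rw [herase l hl hlab, if_neg, Nat.sub_zero]
      intro h
      exact Finset.ne_of_mem_erase hk (Prod.ext_iff.1 h).1
  rw [h1, gaussMoment_add_single (labelCount lab S k₀) _ b₀ _ _ d, ← Finset.sum_filter]
  · simp only [hcond]
    rw [Finset.sum_congr rfl fun l hl => h2 l (Finset.mem_filter.1 hl).1 (Finset.mem_filter.1 hl).2,
      Finset.sum_const, smul_eq_mul, mul_assoc]
    rfl
  · simp [hd]
  · simp [hd]
  · simp [hcount]
  · simp [hcount]

end WickCount

section RootsOfUnity

/-- The primitive root of unity `e^{2πi/n}`. -/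
noncomputable def rootOfUnity (n : ℕ) : ℂ := Complex.exp (2 * Real.pi * Complex.I / n)

lemma rootOfUnity_ne_zero (n : ℕ) : rootOfUnity n ≠ 0 := Complex.exp_ne_zero _

lemma norm_rootOfUnity (n : ℕ) : ‖rootOfUnity n‖ = 1 := by
  rw [rootOfUnity, show (2 * Real.pi * Complex.I / n : ℂ) = ((2 * Real.pi / n : ℝ) : ℂ) * Complex.I
    by push_cast; ring]
  exact Complex.norm_exp_ofReal_mul_I _

lemma norm_rootOfUnity_zpow (n : ℕ) (d : ℤ) : ‖rootOfUnity n ^ d‖ = 1 := by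
  rw [norm_zpow, norm_rootOfUnity, one_zpow]

lemma star_rootOfUnity_zpow (n : ℕ) (d : ℤ) :
    star (rootOfUnity n ^ d) = rootOfUnity n ^ (-d) := by
  rw [zpow_neg, Complex.inv_eq_conj (norm_rootOfUnity_zpow n d)]; rfl

lemma rootOfUnity_zpow_eq_one_iff {n : ℕ} (hn : n ≠ 0) (d : ℤ) :
    rootOfUnity n ^ d = 1 ↔ (n : ℤ) ∣ d :=
  (Complex.isPrimitiveRoot_exp n hn).zpow_eq_one_iff_dvd d

lemma sum_rootOfUnity_zpow {n : ℕ} (hn : n ≠ 0) (d : ℤ) :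
    ∑ i ∈ Finset.range n, rootOfUnity n ^ (d * i) = if (n : ℤ) ∣ d then (n : ℂ) else 0 := by
  simp only [zpow_mul, zpow_natCast]
  split_ifs with h
  · rw [(rootOfUnity_zpow_eq_one_iff hn d).2 h]
    simp
  · have h1 : rootOfUnity n ^ d ≠ 1 := fun h' => h ((rootOfUnity_zpow_eq_one_iff hn d).1 h')
    rw [geom_sum_eq h1, ← zpow_natCast, ← zpow_mul,
      (rootOfUnity_zpow_eq_one_iff hn _).2 (dvd_mul_left _ _)]
    simp

lemma card_filter_dvd_two_mul_sub_le {n : ℕ} (hn : n ≠ 0) {i : ℕ} (hi : i < n) :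
    ((Finset.range n).filter fun j : ℕ => (n : ℤ) ∣ 2 * (i - j : ℤ)).card ≤ 3 := by
  have hn' : (0 : ℤ) < n := by exact_mod_cast Nat.pos_of_ne_zero hn
  have h : ((Finset.range n).filter fun j : ℕ => (n : ℤ) ∣ 2 * (i - j : ℤ)).card ≤
      (Finset.Icc (-1 : ℤ) 1).card := by
    refine Finset.card_le_card_of_injOn (fun j : ℕ => 2 * (i - j : ℤ) / n) ?_ ?_
    · intro j hj
      simp only [Finset.coe_filter, Finset.mem_range, Set.mem_ofPred_eq] at hj
      obtain ⟨hj, c, hc⟩ := hj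
      simp only [Finset.coe_Icc, Set.mem_Icc]
      rw [hc, Int.mul_ediv_cancel_left _ hn'.ne']
      constructor
      · by_contra! h
        have : (n : ℤ) * c ≤ n * (-2) := by gcongr; omega
        omega
      · by_contra! h
        have : (n : ℤ) * 2 ≤ n * c := by gcongr; omega
        omega
    · intro j hj j' hj' h
      simp only [Finset.coe_filter, Finset.mem_range, Set.mem_ofPred_eq] at hj hj' h
      obtain ⟨c, hc⟩ := hj.2
      obtain ⟨c', hc'⟩ := hj'.2
      rw [hc, hc', Int.mul_ediv_cancel_left _ hn'.ne', Int.mul_ediv_cancel_left _ hn'.ne'] at h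
      rw [h] at hc
      omega
  simpa using h

lemma sum_normSq_sum_mul_rootOfUnity_le {n : ℕ} (hn : n ≠ 0) {β : ℕ → ℂ} (hβ : ∀ i, ‖β i‖ = 1) :
    ∑ t ∈ Finset.range n, ‖∑ i ∈ Finset.range n, β i * rootOfUnity n ^ (2 * t * i : ℤ)‖ ^ 2 ≤
      3 * (n : ℝ) ^ 2 := by
  have h : ((∑ t ∈ Finset.range n,
      ‖∑ i ∈ Finset.range n, β i * rootOfUnity n ^ (2 * t * i : ℤ)‖ ^ 2 : ℝ) : ℂ) =
      ∑ i ∈ Finset.range n, ∑ j ∈ Finset.range n, β i * star (β j) *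
        if (n : ℤ) ∣ 2 * (i - j : ℤ) then (n : ℂ) else 0 := by
    push_cast
    simp only [← Complex.mul_conj', map_sum, Finset.sum_mul_sum]
    rw [Finset.sum_comm]
    refine Finset.sum_congr rfl fun i _ => ?_
    rw [Finset.sum_comm]
    refine Finset.sum_congr rfl fun j _ => ?_
    rw [← sum_rootOfUnity_zpow hn, Finset.mul_sum]
    refine Finset.sum_congr rfl fun t _ => ?_
    rw [map_mul, starRingEnd_apply, starRingEnd_apply, star_rootOfUnity_zpow,
      show (2 * (i - j) * t : ℤ) = 2 * t * i + -(2 * t * j) by ring,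
      zpow_add₀ (rootOfUnity_ne_zero n)]
    ring
  have h0 : 0 ≤ ∑ t ∈ Finset.range n,
      ‖∑ i ∈ Finset.range n, β i * rootOfUnity n ^ (2 * t * i : ℤ)‖ ^ 2 := by positivity
  rw [← abs_of_nonneg h0, ← Real.norm_eq_abs, ← Complex.norm_real, h]
  have h1 : ∀ i ∈ Finset.range n, ‖∑ j ∈ Finset.range n, β i * star (β j) *
        (if (n : ℤ) ∣ 2 * (i - j : ℤ) then (n : ℂ) else 0)‖ ≤ 3 * n := by
    intro i hi
    have : ‖∑ j ∈ Finset.range n, β i * star (β j) *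
        (if (n : ℤ) ∣ 2 * (i - j : ℤ) then (n : ℂ) else 0)‖ ≤
        ∑ j ∈ Finset.range n, if (n : ℤ) ∣ 2 * (i - j : ℤ) then (n : ℝ) else 0 := by
      refine norm_sum_le_of_le _ fun j _ => ?_
      rw [norm_mul, norm_mul, norm_star, hβ, hβ]
      split_ifs <;> simp
    refine this.trans ?_
    rw [← Finset.sum_filter, Finset.sum_const, nsmul_eq_mul]
    gcongr
    exact_mod_cast card_filter_dvd_two_mul_sub_le hn (Finset.mem_range.1 hi)
  refine (norm_sum_le_of_le _ h1).trans ?_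
  rw [Finset.sum_const, nsmul_eq_mul, Finset.card_range]
  exact le_of_eq (by ring)

end RootsOfUnity

section Eigenvalues

/-- `z` or its conjugate. -/
def starIf (b : Bool) (z : ℂ) : ℂ := if b then star z else z

lemma norm_starIf (b : Bool) (z : ℂ) : ‖starIf b z‖ = ‖z‖ := by
  cases b <;> simp [starIf]

variable {κ : Type} [DecidableEq κ]

/-- The coefficients of the eigenvalue, at the frequency `t`, of the circulant of colour `r` with
phases `ph`, or of its adjoint. -/
noncomputable def eigenCoef (n : ℕ) (ph : κ → ℕ → ℂ) (r : κ) (b : Bool) (t : ℤ) (x : κ × ℕ) : ℂ :=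
  if x.1 = r then
    ((Real.sqrt n : ℝ) : ℂ)⁻¹ * starIf b (ph r x.2 * rootOfUnity n ^ (t * x.2)) else 0

lemma norm_eigenCoef_le {n : ℕ} {ph : κ → ℕ → ℂ} (hph : ∀ r i, ‖ph r i‖ = 1) (r : κ) (b : Bool)
    (t : ℤ) (x : κ × ℕ) : ‖eigenCoef n ph r b t x‖ ≤ (Real.sqrt n)⁻¹ := by
  unfold eigenCoef
  split_ifs
  · rw [norm_mul, norm_starIf, norm_mul, hph, norm_rootOfUnity_zpow, norm_inv, Complex.norm_real,
      Real.norm_of_nonneg (Real.sqrt_nonneg _)]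
    simp
  · simp

variable [Fintype κ]

/-- The indices of the entries of all circulants of size `n`. -/
def circVars (κ : Type) [Fintype κ] (n : ℕ) : Finset (κ × ℕ) := Finset.univ ×ˢ Finset.range n

lemma inv_sqrt_le_one (n : ℕ) : (Real.sqrt n)⁻¹ ≤ 1 := by
  rcases Nat.eq_zero_or_pos n with rfl | h
  · simp
  · exact inv_le_one_of_one_le₀ (Real.one_le_sqrt.2 (by exact_mod_cast h))

omit [DecidableEq κ] in
lemma card_circVars_mul_le (n : ℕ) :
    ((circVars κ n).card : ℝ) * ((Real.sqrt n)⁻¹) ^ 2 ≤ Fintype.card κ := by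
  rw [circVars, Finset.card_product, Finset.card_range, Finset.card_univ, inv_pow,
    Real.sq_sqrt (Nat.cast_nonneg _)]
  push_cast
  rcases Nat.eq_zero_or_pos n with rfl | h
  · simp
  · have : (n : ℝ) ≠ 0 := by positivity
    rw [mul_assoc, mul_inv_cancel₀ this, mul_one]

lemma sum_eigenCoef_mul {n : ℕ} (ph : κ → ℕ → ℂ) (r r' : κ) (b b' : Bool) (t t' : ℤ) :
    ∑ x ∈ circVars κ n, eigenCoef n ph r b t x * eigenCoef n ph r' b' t' x =
      if r = r' then (n : ℂ)⁻¹ * ∑ i ∈ Finset.range n,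
        starIf b (ph r i * rootOfUnity n ^ (t * i)) *
          starIf b' (ph r i * rootOfUnity n ^ (t' * i)) else 0 := by
  rw [circVars, Finset.sum_product]
  have hn : ((Real.sqrt n : ℝ) : ℂ)⁻¹ * ((Real.sqrt n : ℝ) : ℂ)⁻¹ = (n : ℂ)⁻¹ := by
    rw [← mul_inv, ← Complex.ofReal_mul, Real.mul_self_sqrt (Nat.cast_nonneg _)]; simp
  rw [Finset.sum_eq_single r]
  · split_ifs with h
    · subst h
      rw [Finset.mul_sum]
      refine Finset.sum_congr rfl fun i _ => ?_
      simp only [eigenCoef, if_true]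
      rw [← hn]; ring
    · exact Finset.sum_eq_zero fun i _ => by simp [eigenCoef, h]
  · intro r'' _ h
    exact Finset.sum_eq_zero fun i _ => by simp [eigenCoef, h]
  · simp

omit [DecidableEq κ] [Fintype κ] in
lemma mean_starIf_mul_of_ne {n : ℕ} (hn : n ≠ 0) {ph : κ → ℕ → ℂ} (hph : ∀ r i, ‖ph r i‖ = 1) (r : κ)
    {b b' : Bool} (hb : b ≠ b') (t t' : ℤ) :
    (n : ℂ)⁻¹ * ∑ i ∈ Finset.range n, starIf b (ph r i * rootOfUnity n ^ (t * i)) *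
          starIf b' (ph r i * rootOfUnity n ^ (t' * i)) = if (n : ℤ) ∣ t - t' then 1 else 0 := by
  have key : ∀ t t' : ℤ, ∀ i : ℕ, (ph r i * rootOfUnity n ^ (t * i)) *
      star (ph r i * rootOfUnity n ^ (t' * i)) = rootOfUnity n ^ ((t - t') * i) := by
    intro t t' i
    have h1 : ph r i * star (ph r i) = 1 := by
      have := Complex.mul_conj' (ph r i)
      rw [hph] at this; simpa using this
    rw [star_mul', star_rootOfUnity_zpow, sub_mul, sub_eq_add_neg,
      zpow_add₀ (rootOfUnity_ne_zero n)]
    linear_combination (rootOfUnity n ^ (t * i) * rootOfUnity n ^ (-(t' * i))) * h1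
  have hn' : (n : ℂ) ≠ 0 := by exact_mod_cast hn
  cases b <;> cases b' <;> simp only [ne_eq, not_true_eq_false] at hb
  · simp only [starIf, if_true, Bool.false_eq_true, if_false, key]
    rw [sum_rootOfUnity_zpow hn]
    split_ifs <;> simp [hn']
  · simp only [starIf, if_true, Bool.false_eq_true, if_false, mul_comm (star _), key]
    rw [sum_rootOfUnity_zpow hn, ← neg_sub t t']
    simp only [dvd_neg]
    split_ifs <;> simp [hn']

omit [DecidableEq κ] [Fintype κ] in
lemma mean_norm_mean_starIf_mul_le {n : ℕ} (hn : n ≠ 0) {ph : κ → ℕ → ℂ}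
    (hph : ∀ r i, ‖ph r i‖ = 1) (r : κ) (b : Bool) (s s' : ℤ) :
    (n : ℝ)⁻¹ * ∑ t ∈ Finset.range n, ‖(n : ℂ)⁻¹ * ∑ i ∈ Finset.range n,
      starIf b (ph r i * rootOfUnity n ^ ((t + s) * i)) *
          starIf b (ph r i * rootOfUnity n ^ ((t + s') * i))‖ ≤ Real.sqrt 3 * (Real.sqrt n)⁻¹ := by
  set β : ℕ → ℂ := fun i => ph r i ^ 2 * rootOfUnity n ^ ((s + s') * i) with hβ
  have hβ1 : ∀ i, ‖β i‖ = 1 := fun i => by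
    rw [hβ, norm_mul, norm_pow, hph, norm_rootOfUnity_zpow]; simp
  have h1 : ∀ t : ℕ, ‖(n : ℂ)⁻¹ * ∑ i ∈ Finset.range n,
      starIf b (ph r i * rootOfUnity n ^ ((t + s) * i)) *
          starIf b (ph r i * rootOfUnity n ^ ((t + s') * i))‖ =
      (n : ℝ)⁻¹ * ‖∑ i ∈ Finset.range n, β i * rootOfUnity n ^ (2 * t * i : ℤ)‖ := by
    intro t
    have h2 : ∀ i, starIf b (ph r i * rootOfUnity n ^ ((t + s) * i)) *
          starIf b (ph r i * rootOfUnity n ^ ((t + s') * i)) =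
        starIf b (β i * rootOfUnity n ^ (2 * t * i : ℤ)) := by
      intro i
      have h3 : (ph r i * rootOfUnity n ^ ((t + s) * i)) *
          (ph r i * rootOfUnity n ^ ((t + s') * i)) = β i * rootOfUnity n ^ (2 * t * i : ℤ) := by
        rw [hβ]
        dsimp only
        rw [show (ph r i * rootOfUnity n ^ ((t + s) * i)) *
          (ph r i * rootOfUnity n ^ ((t + s') * i)) = ph r i ^ 2 *
          (rootOfUnity n ^ ((t + s) * i) * rootOfUnity n ^ ((t + s') * i)) by ring,
          ← zpow_add₀ (rootOfUnity_ne_zero n), mul_assoc, ← zpow_add₀ (rootOfUnity_ne_zero n)]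
        congr 2
        ring
      rw [← h3]
      cases b
      · simp [starIf]
      · simp [starIf]
    simp only [h2]
    rw [norm_mul, norm_inv, Complex.norm_natCast]
    congr 1
    cases b
    · simp [starIf]
    · simp only [starIf, if_true]
      rw [← star_sum, norm_star]
  simp only [h1]
  set f : ℕ → ℝ := fun t => ‖∑ i ∈ Finset.range n, β i * rootOfUnity n ^ (2 * t * i : ℤ)‖
  have hn' : (0 : ℝ) < n := by exact_mod_cast Nat.pos_of_ne_zero hn
  have h4 : (∑ t ∈ Finset.range n, f t) ^ 2 ≤ n * (3 * (n : ℝ) ^ 2) := by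
    have := sq_sum_le_card_mul_sum_sq (s := Finset.range n) (f := f)
    rw [Finset.card_range] at this
    refine this.trans ?_
    gcongr
    exact sum_normSq_sum_mul_rootOfUnity_le hn hβ1
  have h5 := Real.le_sqrt_of_sq_le h4
  rw [← Finset.mul_sum]
  calc (n : ℝ)⁻¹ * ((n : ℝ)⁻¹ * ∑ t ∈ Finset.range n, f t)
      ≤ (n : ℝ)⁻¹ * ((n : ℝ)⁻¹ * Real.sqrt (n * (3 * (n : ℝ) ^ 2))) := by gcongr
    _ = _ := by
      rw [show (n : ℝ) * (3 * (n : ℝ) ^ 2) = 3 * n * n ^ 2 by ring,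
        Real.sqrt_mul (by positivity), Real.sqrt_sq hn'.le, Real.sqrt_mul (by norm_num)]
      have hs : Real.sqrt n ≠ 0 := (Real.sqrt_pos.2 hn').ne'
      field_simp
      rw [Real.sq_sqrt hn'.le]

/-- The eigenvalue at the frequency `t` as a linear form in the entries. -/
noncomputable def eigenForm (n : ℕ) (ph : κ → ℕ → ℂ) (r : κ) (b : Bool) (t : ℤ) :
    MvPolynomial (κ × ℕ) ℂ :=
  linForm (circVars κ n) (eigenCoef n ph r b t)

variable {ι : Type}

/-- The average over the frequency of a joint moment of eigenvalues at shifted frequencies. -/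
noncomputable def eigenAverage (n : ℕ) (mom : κ × ℕ → ℕ → ℂ) (ph : κ → ℕ → ℂ)
    (lab : ι → (κ × ℤ) × Bool) (S : Finset ι) : ℂ :=
  (n : ℂ)⁻¹ * ∑ t ∈ Finset.range n, momentFunctional mom
    (∏ l ∈ S, eigenForm n ph (lab l).1.1 (lab l).2 (t + (lab l).1.2))

lemma eventually_dvd_sub_iff (s s' : ℤ) : ∀ᶠ n : ℕ in atTop, ((n : ℤ) ∣ s - s' ↔ s = s') := by
  filter_upwards [eventually_gt_atTop (s - s').natAbs] with n hn
  constructor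
  · intro h
    by_contra hne
    have := Int.natAbs_le_of_dvd_ne_zero h (sub_ne_zero.2 hne)
    simp at this
    omega
  · rintro rfl; simp

/-- The eigenvalues at a uniform random frequency and its shifts are asymptotically independent
standard complex Gaussian variables. -/
theorem tendsto_eigenAverage [DecidableEq ι] {K : ℕ → ℝ} {mom : ℕ → κ × ℕ → ℕ → ℂ}
    (hmom : ∀ n, NormalizedMoments K (mom n)) {ph : ℕ → κ → ℕ → ℂ}
    (hph : ∀ n r i, ‖ph n r i‖ = 1) (lab : ι → (κ × ℤ) × Bool) (S : Finset ι) :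
    Tendsto (fun n => eigenAverage n (mom n) (ph n) lab S) atTop (𝓝 (wickCount lab S : ℂ)) := by
  have hsq : Tendsto (fun n : ℕ => (Real.sqrt n)⁻¹) atTop (𝓝 0) :=
    tendsto_inv_atTop_zero.comp (Real.tendsto_sqrt_atTop.comp tendsto_natCast_atTop_atTop)
  induction S using Finset.strongInduction with
  | H S ih =>
  rcases S.eq_empty_or_nonempty with rfl | ⟨l₀, hl₀⟩
  · refine tendsto_const_nhds.congr' ?_
    filter_upwards [eventually_gt_atTop 0] with n hn
    have : (n : ℂ) ≠ 0 := by exact_mod_cast hn.ne'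
    simp [eigenAverage, momentFunctional_one, wickCount, this]
  set S' := S.erase l₀ with hS'
  have hl₀' : l₀ ∉ S' := Finset.notMem_erase _ _
  have hS : S = insert l₀ S' := (Finset.insert_erase hl₀).symm
  set α : ℕ → ℕ → ι → κ × ℕ → ℂ := fun n t l =>
    eigenCoef n (ph n) (lab l).1.1 (lab l).2 (t + (lab l).1.2) with hα
  set cov : ℕ → ℕ → ι → ℂ := fun n t l => ∑ x ∈ circVars κ n, α n t l₀ x * α n t l x with hcov
  set rest : ℕ → ℕ → ι → ℂ := fun n t l => momentFunctional (mom n)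
    (∏ l' ∈ S'.erase l, linForm (circVars κ n) (α n t l')) with hrest
  obtain ⟨B, hB0, hB⟩ := exists_momentFunctional_wick_bound K (Fintype.card κ) S'.card
  obtain ⟨B', hB'0, hB'⟩ := exists_momentFunctional_prod_linForm_bound K (Fintype.card κ) S'.card
  have hrestB : ∀ n t l, ‖rest n t l‖ ≤ B' := fun n t l =>
    hB' (mom n) (hmom n) _ _ _ (by positivity) (inv_sqrt_le_one n) (card_circVars_mul_le n)
      (fun l x => norm_eigenCoef_le (hph n) _ _ _ _) _
      (Finset.card_le_card (Finset.erase_subset _ _))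
  have hmain : Tendsto (fun n => eigenAverage n (mom n) (ph n) lab S -
      ∑ l ∈ S', (n : ℂ)⁻¹ * ∑ t ∈ Finset.range n, cov n t l * rest n t l) atTop (𝓝 0) := by
    refine squeeze_zero_norm (a := fun n : ℕ => B * (Real.sqrt n)⁻¹) (fun n => ?_)
      (by simpa using hsq.const_mul B)
    rw [← Finset.mul_sum, Finset.sum_comm, eigenAverage, ← mul_sub, ← Finset.sum_sub_distrib]
    have h1 : ∀ t ∈ Finset.range n, ‖momentFunctional (mom n)
        (∏ l ∈ S, eigenForm n (ph n) (lab l).1.1 (lab l).2 (t + (lab l).1.2)) -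
        ∑ l ∈ S', cov n t l * rest n t l‖ ≤ B * (Real.sqrt n)⁻¹ := by
      intro t _
      rw [hS, Finset.prod_insert hl₀']
      exact hB (mom n) (hmom n) (circVars κ n) (α n t) _ (by positivity) (inv_sqrt_le_one n)
        (card_circVars_mul_le n) (fun l x => norm_eigenCoef_le (hph n) _ _ _ _) S' l₀ le_rfl
    rw [norm_mul, norm_inv, Complex.norm_natCast]
    have h2 := norm_sum_le_of_le _ h1
    rw [Finset.sum_const, nsmul_eq_mul, Finset.card_range] at h2
    refine (mul_le_mul_of_nonneg_left h2 (by positivity)).trans ?_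
    rw [← mul_assoc]
    exact mul_le_of_le_one_left (by positivity) (inv_mul_le_one)
  have hterm : ∀ l ∈ S', Tendsto (fun n : ℕ => (n : ℂ)⁻¹ * ∑ t ∈ Finset.range n,
      cov n t l * rest n t l) atTop (𝓝 (if (lab l₀).1 = (lab l).1 ∧ (lab l₀).2 ≠ (lab l).2 then
        (wickCount lab (S'.erase l) : ℂ) else 0)) := by
    intro l hl
    by_cases hr : (lab l₀).1.1 = (lab l).1.1
    · by_cases hb : (lab l₀).2 = (lab l).2
      · rw [if_neg (by tauto)]
        refine squeeze_zero_norm' (a := fun n : ℕ => Real.sqrt 3 * (Real.sqrt n)⁻¹ * B') ?_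
          (by simpa using (hsq.const_mul (Real.sqrt 3)).mul_const B')
        filter_upwards [eventually_gt_atTop 0] with n hn
        have h1 := mean_norm_mean_starIf_mul_le hn.ne' (hph n) (lab l₀).1.1 (lab l₀).2
          (lab l₀).1.2 (lab l).1.2
        rw [norm_mul, norm_inv, Complex.norm_natCast]
        have h2 : ‖∑ t ∈ Finset.range n, cov n t l * rest n t l‖ ≤
            ∑ t ∈ Finset.range n, ‖cov n t l‖ * B' := by
          refine norm_sum_le_of_le _ fun t _ => ?_
          rw [norm_mul]
          exact mul_le_mul_of_nonneg_left (hrestB _ _ _) (norm_nonneg _)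
        refine (mul_le_mul_of_nonneg_left h2 (by positivity)).trans ?_
        rw [← Finset.sum_mul, ← mul_assoc]
        refine mul_le_mul_of_nonneg_right (le_trans (le_of_eq ?_) h1) hB'0
        congr 1
        refine Finset.sum_congr rfl fun t _ => ?_
        simp only [hcov, hα]
        rw [sum_eigenCoef_mul, if_pos hr, hb]
      · have hcov1 : ∀ n ≠ 0, ∀ t, cov n t l =
            if (n : ℤ) ∣ (lab l₀).1.2 - (lab l).1.2 then 1 else 0 := by
          intro n hn t
          simp only [hcov, hα]
          rw [sum_eigenCoef_mul, if_pos hr, mean_starIf_mul_of_ne hn (hph n) _ hb,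
            add_sub_add_left_eq_sub]
        have hav : ∀ n : ℕ, (n : ℂ)⁻¹ * ∑ t ∈ Finset.range n, rest n t l =
            eigenAverage n (mom n) (ph n) lab (S'.erase l) := fun n => rfl
        by_cases hs : (lab l₀).1.2 = (lab l).1.2
        · rw [if_pos ⟨Prod.ext hr hs, hb⟩]
          refine (ih (S'.erase l) ?_).congr' ?_
          · exact Finset.ssubset_of_subset_of_ssubset (Finset.erase_subset _ _)
              (Finset.erase_ssubset hl₀)
          · filter_upwards [eventually_gt_atTop 0] with n hn
            rw [← hav]
            simp [hcov1 n hn.ne', hs]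
        · rw [if_neg (fun h => hs (Prod.ext_iff.1 h.1).2)]
          refine tendsto_const_nhds.congr' ?_
          filter_upwards [eventually_gt_atTop 0, eventually_dvd_sub_iff (lab l₀).1.2 (lab l).1.2]
            with n hn hdvd
          simp [hcov1 n hn.ne', hdvd, hs]
    · rw [if_neg (fun h => hr (Prod.ext_iff.1 h.1).1)]
      refine tendsto_const_nhds.congr fun n => ?_
      simp only [hcov, hα, sum_eigenCoef_mul, if_neg hr]
      simp
  have := hmain.add (tendsto_finsetSum S' hterm)
  rw [hS, wickCount_insert lab hl₀']
  push_cast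
  refine (this.congr fun n => ?_).trans (le_of_eq ?_)
  · rw [sub_add_cancel, ← hS]
  · rw [zero_add]

end Eigenvalues

section WordMatrices

variable {κ : Type}

/-- A letter of a generalised word: a circulant or its adjoint, or a diagonal matrix whose entries
are the values of a symbol. -/
abbrev MatrixLetter (κ : Type) := (κ × Bool) ⊕ (ℕ → ℕ → ℂ)

/-- The index of the variable in the entry `(i, j)` of a circulant or of its adjoint. -/
def circIndex (n : ℕ) (b : Bool) (i j : Fin n) : ℕ :=
  if b then ((i : ℕ) + n - j) % n else ((j : ℕ) + n - i) % n

/-- The matrix of a letter, with polynomial entries. -/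
noncomputable def letterMatrix (n : ℕ) (ph : κ → ℕ → ℂ) :
    MatrixLetter κ → Matrix (Fin n) (Fin n) (MvPolynomial (κ × ℕ) ℂ)
  | .inl (r, b) => Matrix.of fun i j =>
      MvPolynomial.C (((Real.sqrt n : ℝ) : ℂ)⁻¹ * starIf b (ph r (circIndex n b i j))) *
        MvPolynomial.X (r, circIndex n b i j)
  | .inr f => Matrix.diagonal fun j => MvPolynomial.C (f n j)

/-- The matrix of a word. -/
noncomputable def wordMatrix (n : ℕ) (ph : κ → ℕ → ℂ) (w : List (MatrixLetter κ)) :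
    Matrix (Fin n) (Fin n) (MvPolynomial (κ × ℕ) ℂ) :=
  (w.map (letterMatrix n ph)).prod

/-- The normalised expected trace of a word. -/
noncomputable def wordMean (n : ℕ) (mom : κ × ℕ → ℕ → ℂ) (ph : κ → ℕ → ℂ)
    (w : List (MatrixLetter κ)) : ℂ :=
  (n : ℂ)⁻¹ * momentFunctional mom (wordMatrix n ph w).trace

lemma wordMatrix_append (n : ℕ) (ph : κ → ℕ → ℂ) (u v : List (MatrixLetter κ)) :
    wordMatrix n ph (u ++ v) = wordMatrix n ph u * wordMatrix n ph v := by
  simp [wordMatrix]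

lemma wordMatrix_cons (n : ℕ) (ph : κ → ℕ → ℂ) (x : MatrixLetter κ) (v : List (MatrixLetter κ)) :
    wordMatrix n ph (x :: v) = letterMatrix n ph x * wordMatrix n ph v := by
  simp [wordMatrix]

/-- The vector with entries `ω^{tj}`. -/
noncomputable def fourierVec (κ : Type) (n : ℕ) (t : ℤ) : Fin n → MvPolynomial (κ × ℕ) ℂ :=
  fun j => MvPolynomial.C (rootOfUnity n ^ (t * (j : ℕ)))

lemma rootOfUnity_zpow_congr {n : ℕ} (hn : n ≠ 0) {d d' : ℤ} (h : (n : ℤ) ∣ d - d') :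
    rootOfUnity n ^ d = rootOfUnity n ^ d' := by
  have := (rootOfUnity_zpow_eq_one_iff hn _).2 h
  rwa [zpow_sub₀ (rootOfUnity_ne_zero n), div_eq_one_iff_eq
    (zpow_ne_zero _ (rootOfUnity_ne_zero n))] at this

lemma dvd_sub_sub_sub_mod {n : ℕ} (i j : Fin n) :
    (n : ℤ) ∣ (j : ℕ) - (i : ℕ) - (((j : ℕ) + n - i) % n : ℕ) := by
  have h := Nat.div_add_mod ((j : ℕ) + n - i) n
  have h2 := i.2
  refine ⟨(((j : ℕ) + n - i) / n : ℕ) - 1, ?_⟩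
  have h3 : ((n * (((j : ℕ) + n - i) / n) + ((j : ℕ) + n - i) % n : ℕ) : ℤ) = j + n - i := by
    rw [h]; omega
  push_cast at h3 ⊢
  push_cast [Nat.cast_sub (show (i : ℕ) ≤ j + n by omega)] at h3 ⊢
  linarith

lemma sum_circIndex {R : Type*} [AddCommMonoid R] {n : ℕ} (b : Bool) (i : Fin n) (f : ℕ → R) :
    ∑ j : Fin n, f (circIndex n b i j) = ∑ d ∈ Finset.range n, f d := by
  have : NeZero n := ⟨by have := i.2; omega⟩
  rw [Finset.sum_range]
  cases b
  · refine Fintype.sum_equiv (Equiv.subRight i) _ _ fun j => ?_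
    congr 1
    simp only [circIndex, Equiv.subRight_apply, Fin.sub_def, Bool.false_eq_true, if_false]
    congr 1
    have := i.2
    omega
  · refine Fintype.sum_equiv (Equiv.subLeft i) _ _ fun j => ?_
    congr 1
    simp only [circIndex, Equiv.subLeft_apply, Fin.sub_def, if_true]
    congr 1
    have := j.2
    omega

variable [DecidableEq κ] [Fintype κ]

lemma eigenForm_eq_sum (n : ℕ) (ph : κ → ℕ → ℂ) (r : κ) (b : Bool) (t : ℤ) :
    eigenForm n ph r b t = ∑ d ∈ Finset.range n, MvPolynomial.C (((Real.sqrt n : ℝ) : ℂ)⁻¹ *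
      starIf b (ph r d * rootOfUnity n ^ (t * d))) * MvPolynomial.X (r, d) := by
  rw [eigenForm, linForm, circVars, Finset.sum_product, Finset.sum_eq_single r]
  · simp [eigenCoef]
  · intro r'' _ h
    exact Finset.sum_eq_zero fun i _ => by simp [eigenCoef, h]
  · simp

lemma letterMatrix_inl_mulVec_fourierVec (n : ℕ) (ph : κ → ℕ → ℂ) (r : κ) (b : Bool) (t : ℤ) :
    (letterMatrix n ph (.inl (r, b))).mulVec (fourierVec κ n t) =
      eigenForm n ph r b t • fourierVec κ n t := by
  funext i
  have hn : n ≠ 0 := by have := i.2; omega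
  rw [Pi.smul_apply, smul_eq_mul, eigenForm_eq_sum, Finset.sum_mul, ← sum_circIndex b i]
  simp only [Matrix.mulVec, dotProduct]
  refine Finset.sum_congr rfl fun j _ => ?_
  have h1 : rootOfUnity n ^ (t * (j : ℕ)) =
      starIf b (rootOfUnity n ^ (t * (circIndex n b i j : ℕ))) * rootOfUnity n ^ (t * (i : ℕ)) := by
    cases b
    · simp only [starIf, circIndex, Bool.false_eq_true, if_false]
      rw [← zpow_add₀ (rootOfUnity_ne_zero n), ← mul_add]
      refine rootOfUnity_zpow_congr hn ?_
      rw [← mul_sub]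
      refine Dvd.dvd.mul_left ?_ _
      obtain ⟨c, hc⟩ := dvd_sub_sub_sub_mod i j
      exact ⟨c, by linarith⟩
    · simp only [starIf, circIndex, if_true]
      rw [star_rootOfUnity_zpow, ← zpow_add₀ (rootOfUnity_ne_zero n), ← mul_neg, ← mul_add]
      refine rootOfUnity_zpow_congr hn ?_
      rw [← mul_sub]
      refine Dvd.dvd.mul_left ?_ _
      rw [← dvd_neg]
      obtain ⟨c, hc⟩ := dvd_sub_sub_sub_mod j i
      exact ⟨c, by linarith⟩
  have h2 : ∀ z w : ℂ, starIf b (z * w) = starIf b z * starIf b w := by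
    intro z w
    cases b <;> simp [starIf]
  simp only [letterMatrix, fourierVec, Matrix.of_apply]
  rw [h1, h2]
  simp only [map_mul]
  ring

/-- The symbol of the `m`-th power of the clock matrix. -/
noncomputable def clockSymbol (m : ℤ) (n j : ℕ) : ℂ := rootOfUnity n ^ (m * j)

omit [DecidableEq κ] [Fintype κ] in
lemma letterMatrix_clockSymbol_mulVec_fourierVec (n : ℕ) (ph : κ → ℕ → ℂ) (m t : ℤ) :
    (letterMatrix n ph (.inr (clockSymbol m))).mulVec (fourierVec κ n t) =
      fourierVec κ n (t + m) := by
  funext i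
  simp only [letterMatrix, Matrix.mulVec_diagonal, fourierVec, clockSymbol]
  rw [← map_mul, ← zpow_add₀ (rootOfUnity_ne_zero n), ← add_mul, add_comm]

/-- A word in circulants, their adjoints, and powers of the clock matrix. -/
abbrev ClockWord (κ : Type) := List ((κ × Bool) ⊕ ℤ)

/-- The word of matrix letters of a clock word. -/
noncomputable def clockLetters {κ : Type} (w : ClockWord κ) : List (MatrixLetter κ) :=
  w.map (Sum.map id clockSymbol)

/-- The total exponent of the clock matrix. -/
def clockShift {κ : Type} : ClockWord κ → ℤ
  | [] => 0
  | .inl _ :: w => clockShift w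
  | .inr m :: w => m + clockShift w

/-- The circulant letters, with the exponent of the clock matrices to their right. -/
def clockLabels {κ : Type} : ClockWord κ → List ((κ × ℤ) × Bool)
  | [] => []
  | .inl (r, b) :: w => ((r, clockShift w), b) :: clockLabels w
  | .inr _ :: w => clockLabels w

lemma wordMatrix_mulVec_fourierVec (n : ℕ) (ph : κ → ℕ → ℂ) (w : ClockWord κ) (t : ℤ) :
    (wordMatrix n ph (clockLetters w)).mulVec (fourierVec κ n t) =
      ((clockLabels w).map fun x => eigenForm n ph x.1.1 x.2 (t + x.1.2)).prod •
        fourierVec κ n (t + clockShift w) := by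
  induction w with
  | nil => simp [wordMatrix, clockLetters, clockLabels, clockShift]
  | cons x w ih =>
    have h : wordMatrix n ph (clockLetters (x :: w)) =
      letterMatrix n ph (Sum.map id clockSymbol x) * wordMatrix n ph (clockLetters w) := rfl
    rw [h, ← Matrix.mulVec_mulVec, ih, Matrix.mulVec_smul]
    rcases x with ⟨r, b⟩ | m
    · simp only [Sum.map_inl, id, letterMatrix_inl_mulVec_fourierVec, clockLabels,
        clockShift, List.map_cons, List.prod_cons, smul_smul]
      rw [mul_comm]
    · simp only [Sum.map_inr, letterMatrix_clockSymbol_mulVec_fourierVec, clockLabels,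
        clockShift]
      congr 2
      ring

omit [DecidableEq κ] [Fintype κ] in
lemma trace_eq_of_mulVec_fourierVec {n : ℕ} (hn : n ≠ 0)
    (M : Matrix (Fin n) (Fin n) (MvPolynomial (κ × ℕ) ℂ)) (p : ℤ → MvPolynomial (κ × ℕ) ℂ) (m : ℤ)
    (h : ∀ t, M.mulVec (fourierVec κ n t) = p t • fourierVec κ n (t + m)) :
    M.trace = if (n : ℤ) ∣ m then ∑ t ∈ Finset.range n, p t else 0 := by
  have hn' : (n : ℂ) ≠ 0 := by exact_mod_cast hn
  have hinj : ∀ i j : Fin n, ((n : ℤ) ∣ (j : ℕ) - (i : ℕ)) ↔ i = j := by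
    intro i j
    constructor
    · intro hd
      have h1 := i.2
      have h2 := j.2
      by_contra hne
      have hne' : ((j : ℕ) : ℤ) - (i : ℕ) ≠ 0 := by
        intro h0; exact hne (Fin.ext (by omega))
      have := Int.natAbs_le_of_dvd_ne_zero hd hne'
      simp at this
      omega
    · rintro rfl; simp
  have h1 : (n : ℂ) • M.trace = ∑ t ∈ Finset.range n, ∑ i : Fin n,
      MvPolynomial.C (rootOfUnity n ^ (-(t * (i : ℕ)) : ℤ)) * M.mulVec (fourierVec κ n t) i := by
    simp only [Matrix.mulVec, dotProduct, Finset.mul_sum]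
    rw [Finset.sum_comm, Matrix.trace, Finset.smul_sum]
    refine Finset.sum_congr rfl fun i _ => ?_
    rw [Finset.sum_comm, Finset.sum_eq_single i]
    · rw [Finset.sum_congr rfl (g := fun _ => M i i)]
      · simp [Matrix.diag, MvPolynomial.smul_eq_C_mul]
      · intro t _
        simp only [fourierVec]
        rw [mul_left_comm, ← map_mul, ← zpow_add₀ (rootOfUnity_ne_zero n)]
        simp
    · intro j _ hij
      have h2 : ∀ t ∈ Finset.range n, MvPolynomial.C (rootOfUnity n ^ (-(t * (i : ℕ)) : ℤ)) *
          (M i j * fourierVec κ n t j) =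
          M i j * MvPolynomial.C (rootOfUnity n ^ ((((j : ℕ) : ℤ) - (i : ℕ)) * t)) := by
        intro t _
        simp only [fourierVec]
        rw [mul_left_comm, ← map_mul, ← zpow_add₀ (rootOfUnity_ne_zero n)]
        congr 4
        ring
      rw [Finset.sum_congr rfl h2, ← Finset.mul_sum, ← map_sum, sum_rootOfUnity_zpow hn, if_neg]
      · simp
      · rw [hinj]; exact fun h => hij h.symm
    · simp
  have h3 : (n : ℂ) • M.trace = (n : ℂ) • (if (n : ℤ) ∣ m then ∑ t ∈ Finset.range n, p t else 0) := by
    rw [h1]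
    have h4 : ∀ t ∈ Finset.range n, ∑ i : Fin n,
      MvPolynomial.C (rootOfUnity n ^ (-(t * (i : ℕ)) : ℤ)) * M.mulVec (fourierVec κ n t) i =
        p t * MvPolynomial.C (if (n : ℤ) ∣ m then (n : ℂ) else 0) := by
      intro t _
      rw [h, ← sum_rootOfUnity_zpow hn, Finset.sum_range, map_sum, Finset.mul_sum]
      refine Finset.sum_congr rfl fun i _ => ?_
      simp only [fourierVec, Pi.smul_apply, smul_eq_mul]
      rw [mul_left_comm, ← map_mul, ← zpow_add₀ (rootOfUnity_ne_zero n)]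
      congr 3
      ring
    rw [Finset.sum_congr rfl h4, ← Finset.sum_mul]
    split_ifs
    · rw [MvPolynomial.smul_eq_C_mul, mul_comm]
    · simp
  exact (smul_right_injective _ hn') h3

lemma wordMean_clockWord {n : ℕ} (hn : n ≠ 0) (mom : κ × ℕ → ℕ → ℂ) (ph : κ → ℕ → ℂ)
    (w : ClockWord κ) :
    wordMean n mom ph (clockLetters w) = if (n : ℤ) ∣ clockShift w then
      eigenAverage n mom ph (fun i : Fin (clockLabels w).length => (clockLabels w)[i]) Finset.univ else 0 := by
  rw [wordMean, trace_eq_of_mulVec_fourierVec hn _ _ _ (wordMatrix_mulVec_fourierVec n ph w)]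
  split_ifs
  · rw [eigenAverage, map_sum]
    congr 1
    refine Finset.sum_congr rfl fun t _ => ?_
    congr 1
    exact (Fin.prod_univ_fun_getElem (clockLabels w)
      fun x => eigenForm n ph x.1.1 x.2 (t + x.1.2)).symm
  · simp

theorem tendsto_wordMean_clockWord {K : ℕ → ℝ} {mom : ℕ → κ × ℕ → ℕ → ℂ}
    (hmom : ∀ n, NormalizedMoments K (mom n)) {ph : ℕ → κ → ℕ → ℂ}
    (hph : ∀ n r i, ‖ph n r i‖ = 1) (w : ClockWord κ) :
    Tendsto (fun n => wordMean n (mom n) (ph n) (clockLetters w)) atTop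
      (𝓝 (if clockShift w = 0 then
        (wickCount (fun i : Fin (clockLabels w).length => (clockLabels w)[i]) Finset.univ : ℂ) else 0)) := by
  have h := tendsto_eigenAverage hmom hph (fun i : Fin (clockLabels w).length => (clockLabels w)[i]) Finset.univ
  have h0 : ∀ᶠ n : ℕ in atTop, ((n : ℤ) ∣ clockShift w ↔ clockShift w = 0) := by
    simpa using eventually_dvd_sub_iff (clockShift w) 0
  split_ifs with hs
  · refine h.congr' ?_
    filter_upwards [eventually_gt_atTop 0] with n hn
    rw [wordMean_clockWord hn.ne', hs, if_pos (dvd_zero _)]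
  · refine tendsto_const_nhds.congr' ?_
    filter_upwards [eventually_gt_atTop 0, h0] with n hn hd
    rw [wordMean_clockWord hn.ne', if_neg (by rwa [hd])]

end WordMatrices

section Majorants

open scoped ComplexOrder

variable {σ : Type}

/-- The coefficients of `p` are bounded in absolute value by those of `q`, which are nonnegative. -/
def Majorized (p q : MvPolynomial σ ℂ) : Prop := ∀ m, (‖p.coeff m‖ : ℂ) ≤ q.coeff m

lemma Majorized.coeff_nonneg {p q : MvPolynomial σ ℂ} (h : Majorized p q) (m : σ →₀ ℕ) :
    0 ≤ q.coeff m :=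
  le_trans (by exact_mod_cast norm_nonneg _) (h m)

lemma Majorized.zero_left {p q : MvPolynomial σ ℂ} (h : Majorized p q) : Majorized 0 q :=
  fun m => by simpa using h.coeff_nonneg m

lemma Majorized.sum {ι : Type*} {s : Finset ι} {p q : ι → MvPolynomial σ ℂ}
    (h : ∀ i ∈ s, Majorized (p i) (q i)) : Majorized (∑ i ∈ s, p i) (∑ i ∈ s, q i) := by
  intro m
  rw [MvPolynomial.coeff_sum, MvPolynomial.coeff_sum]
  refine le_trans ?_ (Finset.sum_le_sum fun i hi => h i hi m)
  rw [← Complex.ofReal_sum]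
  exact_mod_cast norm_sum_le _ _

lemma Majorized.mul {p q p' q' : MvPolynomial σ ℂ} (h : Majorized p q) (h' : Majorized p' q') :
    Majorized (p * p') (q * q') := by
  classical
  intro m
  rw [MvPolynomial.coeff_mul, MvPolynomial.coeff_mul]
  refine le_trans (Complex.real_le_real.2 (norm_sum_le _ _)) ?_
  rw [Complex.ofReal_sum]
  refine Finset.sum_le_sum fun x _ => ?_
  rw [norm_mul, Complex.ofReal_mul]
  exact mul_le_mul (h _) (h' _) (by exact_mod_cast norm_nonneg _) (h.coeff_nonneg _)

lemma Majorized.C_mul_X {a b : ℂ} (h : (‖a‖ : ℂ) ≤ b) (x : σ) :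
    Majorized (MvPolynomial.C a * MvPolynomial.X x) (MvPolynomial.C b * MvPolynomial.X x) := by
  classical
  intro m
  simp only [MvPolynomial.coeff_C_mul, MvPolynomial.coeff_X]
  split_ifs <;> simp [h]

lemma Majorized.C {a b : ℂ} (h : (‖a‖ : ℂ) ≤ b) :
    Majorized (MvPolynomial.C a : MvPolynomial σ ℂ) (MvPolynomial.C b) := by
  classical
  intro m
  simp only [MvPolynomial.coeff_C]
  split_ifs <;> simp [h]

lemma Majorized.single_le_sum {ι : Type*} {s : Finset ι} {p q : ι → MvPolynomial σ ℂ}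
    (h : ∀ i ∈ s, Majorized (p i) (q i)) {i : ι} (hi : i ∈ s) :
    Majorized (p i) (∑ i ∈ s, q i) := by
  classical
  have h1 : ∑ j ∈ s, (if j = i then p i else 0) = p i := by simp [hi]
  rw [← h1]
  refine Majorized.sum fun j hj => ?_
  split_ifs with hji
  · rw [← hji]; exact h j hj
  · exact (h j hj).zero_left

/-- The absolute values of the moments. -/
noncomputable def absMoments (mom : σ → ℕ → ℂ) (x : σ) (k : ℕ) : ℂ := ‖mom x k‖

lemma NormalizedMoments.absMoments {K : ℕ → ℝ} {mom : σ → ℕ → ℂ} (h : NormalizedMoments K mom) :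
    NormalizedMoments K (absMoments mom) where
  zero x := by simp [_root_.absMoments, h.zero]
  one x := by simp [_root_.absMoments, h.one]
  two x := by simp [_root_.absMoments, h.two]
  bound x j k hjk := by simpa [_root_.absMoments] using h.bound x j k hjk

lemma Majorized.norm_momentFunctional_le {p q : MvPolynomial σ ℂ} (h : Majorized p q)
    (mom : σ → ℕ → ℂ) :
    ‖momentFunctional mom p‖ ≤ ‖momentFunctional (absMoments mom) q‖ := by
  have h1 : (‖momentFunctional mom p‖ : ℂ) ≤ momentFunctional (absMoments mom) q := by
    rw [momentFunctional_eq_sum, momentFunctional_eq_sum]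
    refine le_trans (Complex.real_le_real.2 (norm_sum_le _ _)) ?_
    rw [Complex.ofReal_sum]
    have hsub : p.support ⊆ q.support := by
      intro m hm
      rw [MvPolynomial.mem_support_iff] at hm ⊢
      intro h0
      have := h m
      rw [h0] at this
      have h2 : ‖p.coeff m‖ ≤ 0 := by exact_mod_cast this
      exact hm (norm_le_zero_iff.1 h2)
    have habs : ∀ m : σ →₀ ℕ, ((‖m.prod mom‖ : ℝ) : ℂ) = m.prod (_root_.absMoments mom) := by
      intro m
      simp [Finsupp.prod, _root_.absMoments]
    have hpos : ∀ m : σ →₀ ℕ, 0 ≤ m.prod (_root_.absMoments mom) := by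
      intro m
      rw [← habs]
      exact_mod_cast norm_nonneg _
    refine le_trans (Finset.sum_le_sum fun m _ => ?_)
      (Finset.sum_le_sum_of_subset_of_nonneg hsub fun m _ _ =>
        mul_nonneg (h.coeff_nonneg m) (hpos m))
    rw [norm_mul, Complex.ofReal_mul, habs]
    exact mul_le_mul_of_nonneg_right (h m) (hpos m)
  exact (Complex.le_def.1 h1).1.trans (Complex.re_le_norm _)

end Majorants

section WordBounds

variable {κ : Type} [DecidableEq κ] [Fintype κ]

/-- All symbols of the word are bounded by `1`. -/
def BoundedSymbols (w : List (MatrixLetter κ)) : Prop :=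
  ∀ f : ℕ → ℕ → ℂ, Sum.inr f ∈ w → ∀ n j, ‖f n j‖ ≤ 1

/-- The clock word obtained by replacing all symbols by `1`. -/
def majorantWord (w : List (MatrixLetter κ)) : ClockWord κ := w.map (Sum.map id fun _ => 0)

omit [DecidableEq κ] [Fintype κ] in
lemma majorized_letterMatrix (n : ℕ) {ph : κ → ℕ → ℂ} (hph : ∀ r i, ‖ph r i‖ = 1)
    (x : MatrixLetter κ) (hx : ∀ f, x = Sum.inr f → ∀ n j, ‖f n j‖ ≤ 1) (i j : Fin n) :
    Majorized (letterMatrix n ph x i j) (letterMatrix n (fun _ _ => 1)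
      (Sum.map id clockSymbol (Sum.map id (fun _ => (0 : ℤ)) x)) i j) := by
  rcases x with ⟨r, b⟩ | f
  · refine Majorized.C_mul_X ?_ _
    have h1 : starIf b 1 = 1 := by cases b <;> simp [starIf]
    rw [norm_mul, norm_starIf, hph, h1, norm_inv, Complex.norm_real,
      Real.norm_of_nonneg (Real.sqrt_nonneg _)]
    simp
  · simp only [letterMatrix, Sum.map_inr, Matrix.diagonal_apply]
    split_ifs
    · refine Majorized.C ?_
      simp only [clockSymbol, zero_mul, zpow_zero]
      have := hx f rfl n i
      exact Complex.real_le_real.2 this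
    · intro m
      simp

omit [DecidableEq κ] [Fintype κ] in
lemma majorized_wordMatrix (n : ℕ) {ph : κ → ℕ → ℂ} (hph : ∀ r i, ‖ph r i‖ = 1)
    {w : List (MatrixLetter κ)} (hw : BoundedSymbols w) (i j : Fin n) :
    Majorized (wordMatrix n ph w i j)
      (wordMatrix n (fun _ _ => 1) (clockLetters (majorantWord w)) i j) := by
  induction w generalizing i with
  | nil =>
    intro m
    simp only [wordMatrix, clockLetters, majorantWord, List.map_nil, List.prod_nil,
      Matrix.one_apply]
    split_ifs
    · classical
      rw [MvPolynomial.coeff_one]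
      split_ifs <;> simp
    · simp
  | cons x w ih =>
    have h : wordMatrix n (fun _ _ => 1) (clockLetters (majorantWord (x :: w))) =
      letterMatrix n (fun _ _ => 1) (Sum.map id clockSymbol (Sum.map id (fun _ => (0 : ℤ)) x)) *
        wordMatrix n (fun _ _ => 1) (clockLetters (majorantWord w)) := rfl
    rw [h, wordMatrix_cons, Matrix.mul_apply, Matrix.mul_apply]
    refine Majorized.sum fun k _ => Majorized.mul ?_ ?_
    · exact majorized_letterMatrix n hph x (fun f hf => hw f (by simp [hf])) i k
    · exact ih (fun f hf => hw f (List.mem_cons_of_mem _ hf)) k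

omit [DecidableEq κ] [Fintype κ] in
lemma clockShift_majorantWord (w : List (MatrixLetter κ)) : clockShift (majorantWord w) = 0 := by
  induction w with
  | nil => rfl
  | cons x w ih =>
    rcases x with x | f
    · exact ih
    · have : clockShift (majorantWord (Sum.inr f :: w)) = 0 + clockShift (majorantWord w) := rfl
      rw [this, ih, zero_add]

omit [DecidableEq κ] [Fintype κ] in
lemma length_clockLabels_le (w : ClockWord κ) : (clockLabels w).length ≤ w.length := by
  induction w with
  | nil => simp [clockLabels]
  | cons x w ih =>
    rcases x with ⟨r, b⟩ | m <;> simp only [clockLabels, List.length_cons] <;> omega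

/-- The expected diagonal entries of a word with symbols bounded by `1` are bounded. -/
lemma exists_momentFunctional_wordMatrix_bound (κ : Type) [DecidableEq κ] [Fintype κ]
    (K : ℕ → ℝ) (m : ℕ) :
    ∃ B : ℝ, 0 ≤ B ∧ ∀ (n : ℕ) (mom : κ × ℕ → ℕ → ℂ) (ph : κ → ℕ → ℂ), NormalizedMoments K mom →
      (∀ r i, ‖ph r i‖ = 1) → ∀ w : List (MatrixLetter κ), w.length ≤ m → BoundedSymbols w →
        ∀ i, ‖momentFunctional mom (wordMatrix n ph w i i)‖ ≤ B := by
  obtain ⟨B, hB0, hB⟩ := exists_momentFunctional_prod_linForm_bound K (Fintype.card κ) m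
  refine ⟨B, hB0, fun n mom ph hmom hph w hwm hw i => ?_⟩
  have h1 := Majorized.single_le_sum (s := Finset.univ)
    (fun j _ => majorized_wordMatrix n hph hw i j) (Finset.mem_univ i)
  refine (h1.norm_momentFunctional_le mom).trans ?_
  have h2 := congrFun (wordMatrix_mulVec_fourierVec n (fun _ _ => 1) (majorantWord w) 0) i
  rw [clockShift_majorantWord] at h2
  simp only [Matrix.mulVec, dotProduct, fourierVec, zero_mul, zpow_zero, map_one, mul_one,
    Pi.smul_apply, smul_eq_mul, add_zero] at h2
  rw [h2, ← Fin.prod_univ_fun_getElem (clockLabels (majorantWord w))]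
  refine hB (absMoments mom) hmom.absMoments _ (fun l : Fin (clockLabels (majorantWord w)).length =>
    eigenCoef n (fun _ _ => 1) (clockLabels (majorantWord w))[l].1.1
      (clockLabels (majorantWord w))[l].2 (0 + (clockLabels (majorantWord w))[l].1.2)) _
    (by positivity) (inv_sqrt_le_one n) (card_circVars_mul_le n)
    (fun l x => norm_eigenCoef_le (by simp) _ _ _ _) _ ?_
  rw [Finset.card_univ, Fintype.card_fin]
  refine (length_clockLabels_le _).trans ?_
  rwa [majorantWord, List.length_map]

omit [DecidableEq κ] [Fintype κ] in
lemma wordMean_append_symbol (n : ℕ) (mom : κ × ℕ → ℕ → ℂ) (ph : κ → ℕ → ℂ)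
    (u v : List (MatrixLetter κ)) (f : ℕ → ℕ → ℂ) :
    wordMean n mom ph (u ++ .inr f :: v) = (n : ℂ)⁻¹ * ∑ j : Fin n,
      f n j * momentFunctional mom (wordMatrix n ph (v ++ u) j j) := by
  rw [wordMean, wordMatrix_append, wordMatrix_cons, wordMatrix_append, Matrix.trace_mul_comm,
    Matrix.mul_assoc, Matrix.trace, map_sum]
  congr 1
  refine Finset.sum_congr rfl fun j _ => ?_
  rw [Matrix.diag_apply, letterMatrix, Matrix.diagonal_mul, ← MvPolynomial.smul_eq_C_mul, map_smul,
    smul_eq_mul]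

/-- The symbol is bounded by `1` and approximable on average by linear combinations of powers of
the clock symbol. -/
structure ApproximableSymbol (f : ℕ → ℕ → ℂ) : Prop where
  bounded : ∀ n j, ‖f n j‖ ≤ 1
  approx : ∀ δ > 0, ∃ c : ℤ →₀ ℂ, ∀ᶠ n : ℕ in atTop,
    (n : ℝ)⁻¹ * ∑ j : Fin n, ‖f n j - c.sum fun m a => a * clockSymbol m n j‖ ≤ δ

lemma exists_tendsto_of_approx {u : ℕ → ℂ}
    (h : ∀ ε > 0, ∃ (u' : ℕ → ℂ) (ℓ : ℂ), Tendsto u' atTop (𝓝 ℓ) ∧ ∀ᶠ n in atTop, ‖u n - u' n‖ ≤ ε) :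
    ∃ ℓ, Tendsto u atTop (𝓝 ℓ) := by
  refine cauchySeq_tendsto_of_complete (Metric.cauchySeq_iff'.2 fun ε hε => ?_)
  obtain ⟨u', ℓ, hu', hn⟩ := h (ε / 6) (by positivity)
  have h1 : ∀ᶠ n in atTop, dist (u n) ℓ < ε / 3 := by
    filter_upwards [hn, (Metric.tendsto_nhds.1 hu') (ε / 6) (by positivity)] with n h1 h2
    rw [← dist_eq_norm] at h1
    linarith [dist_triangle (u n) (u' n) ℓ]
  obtain ⟨N, hN⟩ := eventually_atTop.1 h1
  refine ⟨N, fun n hn => ?_⟩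
  have := dist_triangle_right (u n) (u N) ℓ
  linarith [hN n hn, hN N le_rfl]

lemma approximableSymbol_clockSymbol (m : ℤ) : ApproximableSymbol (clockSymbol m) where
  bounded n j := (norm_rootOfUnity_zpow _ _).le
  approx δ hδ := ⟨Finsupp.single m 1, Eventually.of_forall fun n => by simp [hδ.le]⟩

lemma clockLetters_append_singleton {κ : Type} (u : ClockWord κ) (x : (κ × Bool) ⊕ ℤ)
    (v : List (MatrixLetter κ)) :
    clockLetters u ++ Sum.map id clockSymbol x :: v = clockLetters (u ++ [x]) ++ v := by
  simp [clockLetters]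

/-- The normalised expected trace of a word in circulants and diagonal matrices with approximable
symbols converges, for any sequence of data. -/
theorem exists_tendsto_wordMean {K : ℕ → ℝ} {mom : ℕ → κ × ℕ → ℕ → ℂ}
    (hmom : ∀ n, NormalizedMoments K (mom n)) {ph : ℕ → κ → ℕ → ℂ}
    (hph : ∀ n r i, ‖ph n r i‖ = 1) (w : List (MatrixLetter κ))
    (hw : ∀ f, Sum.inr f ∈ w → ApproximableSymbol f) :
    ∃ ℓ, Tendsto (fun n => wordMean n (mom n) (ph n) w) atTop (𝓝 ℓ) := by
  suffices h : ∀ (v : List (MatrixLetter κ)), (∀ f, Sum.inr f ∈ v → ApproximableSymbol f) →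
      ∀ u : ClockWord κ,
      ∃ ℓ, Tendsto (fun n => wordMean n (mom n) (ph n) (clockLetters u ++ v)) atTop (𝓝 ℓ) from
    h w hw []
  intro v
  induction v with
  | nil =>
    intro _ u
    rw [List.append_nil]
    exact ⟨_, tendsto_wordMean_clockWord hmom hph u⟩
  | cons x v ih =>
    intro hv u
    have hv' : ∀ f, Sum.inr f ∈ v → ApproximableSymbol f :=
      fun f hf => hv f (List.mem_cons_of_mem _ hf)
    rcases x with x | f
    · have := clockLetters_append_singleton u (.inl x) v
      simp only [Sum.map_inl, id] at this
      rw [this]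
      exact ih hv' _
    obtain ⟨B, hB0, hB⟩ := exists_momentFunctional_wordMatrix_bound κ K (v ++ clockLetters u).length
    have hbdd : BoundedSymbols (v ++ clockLetters u) := by
      intro g hg
      rcases List.mem_append.1 hg with hg | hg
      · exact (hv' g hg).bounded
      · obtain ⟨y, _, hy⟩ := List.mem_map.1 hg
        rcases y with y | m
        · simp at hy
        · simp only [Sum.map_inr, Sum.inr.injEq] at hy
          rw [← hy]
          exact (approximableSymbol_clockSymbol m).bounded
    refine exists_tendsto_of_approx fun ε hε => ?_
    obtain ⟨c, hc⟩ := (hv f (by simp)).approx (ε / (B + 1)) (by positivity)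
    have hlim : ∀ m : ℤ, ∃ ℓ, Tendsto (fun n => wordMean n (mom n) (ph n)
        (clockLetters u ++ .inr (clockSymbol m) :: v)) atTop (𝓝 ℓ) := by
      intro m
      have := clockLetters_append_singleton u (.inr m) v
      simp only [Sum.map_inr] at this
      rw [this]
      exact ih hv' _
    choose ℓ hℓ using hlim
    refine ⟨fun n => c.sum fun m a => a * wordMean n (mom n) (ph n)
      (clockLetters u ++ .inr (clockSymbol m) :: v), c.sum fun m a => a * ℓ m,
      tendsto_finsetSum _ fun m _ => (hℓ m).const_mul _, ?_⟩
    filter_upwards [hc] with n hn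
    have h1 : wordMean n (mom n) (ph n) (clockLetters u ++ .inr f :: v) -
        (c.sum fun m a => a * wordMean n (mom n) (ph n)
          (clockLetters u ++ .inr (clockSymbol m) :: v)) =
        (n : ℂ)⁻¹ * ∑ j : Fin n, (f n j - c.sum fun m a => a * clockSymbol m n j) *
          momentFunctional (mom n) (wordMatrix n (ph n) (v ++ clockLetters u) j j) := by
      simp only [wordMean_append_symbol, Finsupp.sum, sub_mul, Finset.sum_sub_distrib, mul_sub]
      congr 1
      simp only [Finset.mul_sum, Finset.sum_mul]
      rw [Finset.sum_comm]
      refine Finset.sum_congr rfl fun j _ => Finset.sum_congr rfl fun m _ => by ring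
    rw [h1, norm_mul, norm_inv, Complex.norm_natCast]
    have h2 : ‖∑ j : Fin n, (f n j - c.sum fun m a => a * clockSymbol m n j) *
          momentFunctional (mom n) (wordMatrix n (ph n) (v ++ clockLetters u) j j)‖ ≤
        ∑ j : Fin n, ‖f n j - c.sum fun m a => a * clockSymbol m n j‖ * B := by
      refine norm_sum_le_of_le _ fun j _ => ?_
      rw [norm_mul]
      exact mul_le_mul_of_nonneg_left (hB n _ _ (hmom n) (hph n) _ le_rfl hbdd j) (norm_nonneg _)
    refine (mul_le_mul_of_nonneg_left h2 (by positivity)).trans ?_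
    rw [← Finset.sum_mul, ← mul_assoc]
    refine (mul_le_mul_of_nonneg_right hn hB0).trans ?_
    rw [div_mul_eq_mul_div, div_le_iff₀ (by positivity)]
    nlinarith

/-- Any two sequences of data give the same limit. -/
theorem tendsto_wordMean_of_tendsto {K K' : ℕ → ℝ} {mom mom' : ℕ → κ × ℕ → ℕ → ℂ}
    (hmom : ∀ n, NormalizedMoments K (mom n)) (hmom' : ∀ n, NormalizedMoments K' (mom' n))
    {ph ph' : ℕ → κ → ℕ → ℂ} (hph : ∀ n r i, ‖ph n r i‖ = 1) (hph' : ∀ n r i, ‖ph' n r i‖ = 1)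
    (w : List (MatrixLetter κ)) (hw : ∀ f, Sum.inr f ∈ w → ApproximableSymbol f) {ℓ : ℂ}
    (h : Tendsto (fun n => wordMean n (mom n) (ph n) w) atTop (𝓝 ℓ)) :
    Tendsto (fun n => wordMean n (mom' n) (ph' n) w) atTop (𝓝 ℓ) := by
  obtain ⟨ℓ', hℓ'⟩ := exists_tendsto_wordMean hmom' hph' w hw
  obtain ⟨ℓ'', hℓ''⟩ := exists_tendsto_wordMean (K := fun k => max (K k) (K' k))
    (mom := fun n => if Even n then mom n else mom' n)
    (ph := fun n => if Even n then ph n else ph' n) (fun n => by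
      split_ifs
      · exact ⟨(hmom n).zero, (hmom n).one, (hmom n).two,
          fun x j k hjk => ((hmom n).bound x j k hjk).trans (le_max_left _ _)⟩
      · exact ⟨(hmom' n).zero, (hmom' n).one, (hmom' n).two,
          fun x j k hjk => ((hmom' n).bound x j k hjk).trans (le_max_right _ _)⟩)
    (fun n r i => by
      split_ifs
      · exact hph n r i
      · exact hph' n r i) w hw
  have he : Tendsto (fun n : ℕ => 2 * n) atTop atTop :=
    tendsto_atTop_mono (fun n => by simp only [id]; omega) tendsto_id
  have ho : Tendsto (fun n : ℕ => 2 * n + 1) atTop atTop :=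
    tendsto_atTop_mono (fun n => by simp only [id]; omega) tendsto_id
  have h1 : ℓ'' = ℓ := by
    refine tendsto_nhds_unique (hℓ''.comp he) ((h.comp he).congr fun n => ?_)
    simp
  have h2 : ℓ'' = ℓ' := by
    refine tendsto_nhds_unique (hℓ''.comp ho) ((hℓ'.comp ho).congr fun n => ?_)
    have : ¬ Even (2 * n + 1) := by simp
    simp [this]
  rwa [← h1, h2]

end WordBounds

section DiagonalSymbol

/-- The symbol of `D_n(θ)`. -/
noncomputable def diagSymbol (θ : ℝ) (n j : ℕ) : ℂ := eta θ n ^ j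

lemma diagSymbol_eq (θ : ℝ) (n j : ℕ) :
    diagSymbol θ n j = Complex.exp (((θ * (j / n) : ℝ) : ℂ) * Complex.I) := by
  rw [diagSymbol, eta, ← Complex.exp_nat_mul]
  congr 1
  push_cast
  ring

lemma norm_eta (θ : ℝ) (n : ℕ) : ‖eta θ n‖ = 1 := by
  have := diagSymbol_eq θ n 1
  rw [diagSymbol, pow_one] at this
  rw [this]
  exact Complex.norm_exp_ofReal_mul_I _

lemma norm_diagSymbol (θ : ℝ) (n j : ℕ) : ‖diagSymbol θ n j‖ = 1 := by
  rw [diagSymbol, norm_pow, norm_eta, one_pow]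

lemma star_diagSymbol (θ : ℝ) (n j : ℕ) : star (diagSymbol θ n j) = diagSymbol (-θ) n j := by
  rw [diagSymbol_eq, diagSymbol_eq, Complex.star_def, ← Complex.exp_conj, map_mul,
    Complex.conj_ofReal, Complex.conj_I]
  congr 1
  push_cast
  ring

lemma exists_trigPolynomial_approx {g : ℝ → ℂ} (hg : Continuous g) (h01 : g 0 = g 1) {ε : ℝ}
    (hε : 0 < ε) : ∃ c : ℤ →₀ ℂ, ∀ n j : ℕ, j < n →
      ‖g ((j : ℝ) / n) - c.sum fun m a => a * clockSymbol m n j‖ ≤ ε := by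
  have : Fact ((0 : ℝ) < 1) := ⟨zero_lt_one⟩
  let G : C(AddCircle (1 : ℝ), ℂ) :=
    ⟨AddCircle.liftIco 1 0 g, AddCircle.liftIco_continuous (by simpa using h01) hg.continuousOn⟩
  have hG : G ∈ (Submodule.span ℂ (Set.range (@fourier (1 : ℝ)))).topologicalClosure := by
    rw [span_fourier_closure_eq_top]; trivial
  obtain ⟨p, hp, hpG⟩ := Metric.mem_closure_iff.1 hG ε hε
  obtain ⟨c, hc⟩ := (Finsupp.mem_span_range_iff_exists_finsupp).1 hp
  refine ⟨c, fun n j hj => ?_⟩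
  have hn : (0 : ℝ) < n := by exact_mod_cast (by omega : 0 < n)
  have h1 : G (((j : ℝ) / n : ℝ) : AddCircle (1 : ℝ)) = g ((j : ℝ) / n) := by
    refine AddCircle.liftIco_coe_apply ⟨by positivity, ?_⟩
    rw [zero_add, div_lt_one hn]
    exact_mod_cast hj
  have h2 : p (((j : ℝ) / n : ℝ) : AddCircle (1 : ℝ)) =
      c.sum fun m a => a * clockSymbol m n j := by
    rw [← hc, Finsupp.sum, Finsupp.sum, ContinuousMap.coe_sum, Finset.sum_apply]
    refine Finset.sum_congr rfl fun m _ => ?_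
    rw [ContinuousMap.smul_apply, smul_eq_mul, fourier_coe_apply, clockSymbol, rootOfUnity,
      ← Complex.exp_int_mul]
    congr 2
    push_cast
    field_simp
  rw [← h1, ← h2, ← dist_eq_norm]
  exact (ContinuousMap.dist_apply_le_dist _).trans hpG.le

lemma card_filter_lt_le {n : ℕ} {C : ℝ} (hC : 0 < C) :
    (((Finset.range n).filter fun j : ℕ => C * (1 - (j : ℝ) / n) < (j : ℝ) / n).card : ℝ) ≤
      n / (1 + C) := by
  have h : ((Finset.range n).filter fun j : ℕ => C * (1 - (j : ℝ) / n) < (j : ℝ) / n).card ≤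
      (Finset.Icc 1 ⌊(n : ℝ) / (1 + C)⌋₊).card := by
    refine Finset.card_le_card_of_injOn (fun j => n - j) ?_ ?_
    · intro j hj
      simp only [Finset.coe_filter, Finset.mem_range, Set.mem_ofPred_eq] at hj
      obtain ⟨hj, hlt⟩ := hj
      have hn : (0 : ℝ) < n := by exact_mod_cast (by omega : 0 < n)
      simp only [Finset.coe_Icc, Set.mem_Icc]
      refine ⟨by omega, Nat.le_floor ?_⟩
      rw [Nat.cast_sub hj.le, le_div_iff₀ (by positivity)]
      have h1 : (j : ℝ) / n * n = j := div_mul_cancel₀ _ hn.ne'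
      have h2 := mul_lt_mul_of_pos_right hlt hn
      rw [mul_assoc, sub_mul, h1] at h2
      linarith
    · intro i hi j hj hij
      simp only [Finset.coe_filter, Finset.mem_range, Set.mem_ofPred_eq] at hi hj hij
      omega
  rw [Nat.card_Icc, Nat.add_sub_cancel] at h
  exact (Nat.cast_le.2 h).trans (Nat.floor_le (by positivity))

lemma approximableSymbol_diagSymbol (θ : ℝ) : ApproximableSymbol (diagSymbol θ) where
  bounded n j := (norm_diagSymbol θ n j).le
  approx δ hδ := by
    set C : ℝ := 4 / δ with hC
    have hC0 : 0 < C := by positivity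
    set h : ℝ → ℝ := fun u => min u (C * (1 - u)) with hh
    set g : ℝ → ℂ := fun u => Complex.exp (((θ * h u : ℝ) : ℂ) * Complex.I) with hg
    have hgc : Continuous g := by fun_prop
    have h01 : g 0 = g 1 := by
      have e0 : h 0 = 0 := by simp [hh, hC0.le]
      have e1 : h 1 = 0 := by simp [hh]
      simp only [hg, e0, e1]
    obtain ⟨c, hc⟩ := exists_trigPolynomial_approx hgc h01 (ε := δ / 2) (by positivity)
    refine ⟨c, Eventually.of_forall fun n => ?_⟩
    have hterm : ∀ j ∈ Finset.range n, ‖diagSymbol θ n j - c.sum fun m a => a * clockSymbol m n j‖ ≤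
        δ / 2 + if C * (1 - (j : ℝ) / n) < (j : ℝ) / n then 2 else 0 := by
      intro j hj
      have h1 := hc n j (Finset.mem_range.1 hj)
      have h2 : ‖diagSymbol θ n j - g ((j : ℝ) / n)‖ ≤
          if C * (1 - (j : ℝ) / n) < (j : ℝ) / n then 2 else 0 := by
        split_ifs with hlt
        · refine (norm_sub_le _ _).trans ?_
          rw [norm_diagSymbol, hg, Complex.norm_exp_ofReal_mul_I]
          norm_num
        · rw [diagSymbol_eq]
          simp only [hg, hh]
          rw [min_eq_left (not_lt.1 hlt), sub_self, norm_zero]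
      have h3 := norm_sub_le_norm_sub_add_norm_sub (diagSymbol θ n j) (g ((j : ℝ) / n))
        (c.sum fun m a => a * clockSymbol m n j)
      linarith
    rw [← Finset.sum_range fun j => ‖diagSymbol θ n j - c.sum fun m a => a * clockSymbol m n j‖]
    rcases Nat.eq_zero_or_pos n with rfl | hn
    · simp [hδ.le]
    have hn' : (0 : ℝ) < n := by exact_mod_cast hn
    rw [inv_mul_le_iff₀ hn']
    refine (Finset.sum_le_sum hterm).trans ?_
    rw [Finset.sum_add_distrib, ← Finset.sum_filter, Finset.sum_const, Finset.sum_const,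
      nsmul_eq_mul, nsmul_eq_mul, Finset.card_range]
    have h4 := card_filter_lt_le (n := n) hC0
    have h5 : (n : ℝ) / (1 + C) ≤ n * (δ / 4) := by
      rw [div_eq_mul_inv]
      gcongr
      rw [inv_le_comm₀ (by positivity) (by positivity), inv_div]
      linarith
    nlinarith

/-- The Riemann sums of `e^{iau}` converge to its integral over the unit interval. -/
lemma tendsto_mean_diagSymbol (a : ℝ) :
    Tendsto (fun n : ℕ => (n : ℂ)⁻¹ * ∑ j ∈ Finset.range n, diagSymbol a n j) atTop
      (𝓝 (∫ u in (0 : ℝ)..1, Complex.exp (Complex.I * a * u))) := by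
  rcases eq_or_ne a 0 with rfl | ha
  · have h1 : ∫ u in (0 : ℝ)..1, Complex.exp (Complex.I * (0 : ℝ) * u) = 1 := by simp
    rw [h1]
    refine tendsto_const_nhds.congr' ?_
    filter_upwards [eventually_gt_atTop 0] with n hn
    have : (n : ℂ) ≠ 0 := by exact_mod_cast hn.ne'
    simp [diagSymbol, eta, this]
  have hIa : Complex.I * a ≠ 0 := mul_ne_zero Complex.I_ne_zero (by exact_mod_cast ha)
  rw [integral_exp_mul_complex hIa]
  simp only [Complex.ofReal_one, mul_one, Complex.ofReal_zero, mul_zero, Complex.exp_zero]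
  have hder : HasDerivAt (fun x : ℂ => Complex.exp (Complex.I * a * x)) (Complex.I * a) 0 := by
    have := ((hasDerivAt_id (0 : ℂ)).const_mul (Complex.I * a)).cexp
    simpa using this
  have hslope := hasDerivAt_iff_tendsto_slope_zero.1 hder
  have hinv : Tendsto (fun n : ℕ => (n : ℂ)⁻¹) atTop (𝓝[≠] 0) := by
    refine tendsto_nhdsWithin_iff.2 ⟨?_, ?_⟩
    · exact tendsto_inv_atTop_nhds_zero_nat
    · filter_upwards [eventually_gt_atTop 0] with n hn
      simpa using hn.ne'
  have hlim := (hslope.comp hinv).inv₀ hIa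
  have hlim2 := hlim.const_mul (Complex.exp (Complex.I * a) - 1)
  rw [← div_eq_mul_inv] at hlim2
  refine hlim2.congr' ?_
  have hne : ∀ᶠ n : ℕ in atTop, eta a n ≠ 1 := by
    have h2 := (hslope.comp hinv).eventually_ne hIa
    filter_upwards [h2] with n hn h3
    apply hn
    have h4 : Complex.exp (Complex.I * a * (n : ℂ)⁻¹) = 1 := by
      rw [← h3, eta, div_eq_mul_inv]
    simp [h4]
  filter_upwards [hne, eventually_gt_atTop 0] with n hn hn0
  have hn0' : (n : ℂ) ≠ 0 := by exact_mod_cast hn0.ne'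
  have h5 : eta a n ^ n = Complex.exp (Complex.I * a) := by
    rw [eta, ← Complex.exp_nat_mul]
    congr 1
    field_simp
  have h6 : Complex.exp (Complex.I * a * (n : ℂ)⁻¹) = eta a n := by
    rw [eta, div_eq_mul_inv]
  simp only [diagSymbol]
  rw [geom_sum_eq hn, h5]
  simp only [Function.comp, zero_add, mul_zero, Complex.exp_zero, h6, inv_inv, smul_eq_mul, mul_inv]
  rw [div_eq_mul_inv]
  ring

end DiagonalSymbol

section GaussianMoments

lemma integral_stdComplexGaussian {F : ℂ → ℂ} (hF : Continuous F) :
    ∫ z, F z ∂stdComplexGaussian = ∫ x : ℝ × ℝ, (Real.pi⁻¹ * Real.exp (-(x.1 ^ 2 + x.2 ^ 2))) •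
      F ((x.1 : ℂ) + (x.2 : ℂ) * Complex.I) := by
  have hv : (1 / 2 : NNReal) ≠ 0 := by norm_num
  have hm : Measurable fun z : ℝ × ℝ => gaussianPDF 0 (1 / 2) z.1 * gaussianPDF 0 (1 / 2) z.2 :=
    ((measurable_gaussianPDF _ _).comp measurable_fst).mul
      ((measurable_gaussianPDF _ _).comp measurable_snd)
  rw [stdComplexGaussian, integral_map (by fun_prop) hF.aestronglyMeasurable,
    gaussianReal_of_var_ne_zero _ hv, prod_withDensity (measurable_gaussianPDF _ _)
    (measurable_gaussianPDF _ _), integral_withDensity_eq_integral_toReal_smul hm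
    (ae_of_all _ fun _ => ENNReal.mul_lt_top gaussianPDF_lt_top gaussianPDF_lt_top)]
  refine integral_congr_ae (ae_of_all _ fun x => ?_)
  dsimp only
  rw [ENNReal.toReal_mul, toReal_gaussianPDF, toReal_gaussianPDF, gaussianPDFReal, gaussianPDFReal]
  congr 1
  have h1 : Real.sqrt (2 * Real.pi * ((1 / 2 : NNReal) : ℝ)) = Real.sqrt Real.pi := by
    congr 1; push_cast; ring
  rw [h1, mul_mul_mul_comm, ← Real.exp_add, ← mul_inv, Real.mul_self_sqrt Real.pi_pos.le]
  congr 2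
  push_cast
  ring

lemma integral_Ioo_exp_int_mul (d : ℤ) :
    ∫ θ in Set.Ioo (-Real.pi) Real.pi, Complex.exp ((d : ℂ) * Complex.I * θ) =
      ((if d = 0 then 2 * Real.pi else 0 : ℝ) : ℂ) := by
  rw [← integral_Ioc_eq_integral_Ioo, ← intervalIntegral.integral_of_le (by linarith [Real.pi_pos])]
  split_ifs with h
  · subst h
    simp
    ring
  · have hd : (d : ℂ) * Complex.I ≠ 0 := mul_ne_zero (by exact_mod_cast h) Complex.I_ne_zero
    rw [integral_exp_mul_complex hd, Complex.ofReal_zero, div_eq_zero_iff]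
    left
    rw [sub_eq_zero, Complex.exp_eq_exp_iff_exists_int]
    refine ⟨d, ?_⟩
    push_cast
    ring

lemma integral_Ioi_pow_mul_exp_neg_sq (p : ℕ) :
    ∫ r in Set.Ioi (0 : ℝ), r ^ (2 * p + 1) * Real.exp (-r ^ 2) = p.factorial / 2 := by
  have h := integral_rpow_mul_exp_neg_rpow (p := 2) (q := 2 * p + 1) (by norm_num)
    (by have : (0 : ℝ) ≤ p := Nat.cast_nonneg _; linarith)
  rw [show ((2 * p + 1 + 1 : ℝ) / 2) = p + 1 by ring, Real.Gamma_nat_eq_factorial] at h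
  rw [show (p.factorial : ℝ) / 2 = 1 / 2 * p.factorial by ring, ← h]
  refine setIntegral_congr_fun measurableSet_Ioi fun r _ => ?_
  rw [show (2 * p + 1 : ℝ) = ((2 * p + 1 : ℕ) : ℝ) by push_cast; ring, Real.rpow_natCast,
    Real.rpow_two]

/-- The `*`-moments of the standard complex Gaussian law. -/
lemma integral_pow_mul_star_pow_stdComplexGaussian (c : Bool → ℕ) :
    ∫ z, z ^ c false * star z ^ c true ∂stdComplexGaussian = gaussMoment c := by
  set p := c false
  set q := c true
  rw [integral_stdComplexGaussian (by fun_prop), ← integral_comp_polarCoord_symm, polarCoord_target]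
  have h1 : ∀ x : ℝ × ℝ, x.1 • ((Real.pi⁻¹ * Real.exp (-((polarCoord.symm x).1 ^ 2 +
      (polarCoord.symm x).2 ^ 2))) • ((((polarCoord.symm x).1 : ℂ) +
        ((polarCoord.symm x).2 : ℂ) * Complex.I) ^ p * star (((polarCoord.symm x).1 : ℂ) +
        ((polarCoord.symm x).2 : ℂ) * Complex.I) ^ q)) =
      ((Real.pi⁻¹ * (x.1 ^ (p + q + 1) * Real.exp (-x.1 ^ 2)) : ℝ) : ℂ) *
        Complex.exp (((p - q : ℤ) : ℂ) * Complex.I * x.2) := by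
    rintro ⟨r, θ⟩
    simp only [polarCoord_symm_apply]
    have e1 : (r * Real.cos θ) ^ 2 + (r * Real.sin θ) ^ 2 = r ^ 2 := by
      have := Real.sin_sq_add_cos_sq θ
      linear_combination r ^ 2 * this
    have e2 : ((r * Real.cos θ : ℝ) : ℂ) + ((r * Real.sin θ : ℝ) : ℂ) * Complex.I =
        r * Complex.exp (θ * Complex.I) := by
      rw [Complex.exp_mul_I]; push_cast; ring
    have e3 : star ((r : ℂ) * Complex.exp (θ * Complex.I)) = r * Complex.exp (-(θ * Complex.I)) := by
      rw [Complex.star_def, map_mul, ← Complex.exp_conj, map_mul, Complex.conj_ofReal,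
        Complex.conj_ofReal, Complex.conj_I, mul_neg]
    rw [e1, e2, e3, mul_pow, mul_pow, ← Complex.exp_nat_mul, ← Complex.exp_nat_mul,
      Complex.real_smul, Complex.real_smul]
    have e4 : Complex.exp (((p - q : ℤ) : ℂ) * Complex.I * θ) =
        Complex.exp (p * (θ * Complex.I)) * Complex.exp (q * -(θ * Complex.I)) := by
      rw [← Complex.exp_add]; congr 1; push_cast; ring
    rw [e4]
    push_cast
    ring
  simp only [h1]
  rw [Measure.volume_eq_prod, setIntegral_prod_mul
    (fun r : ℝ => ((Real.pi⁻¹ * (r ^ (p + q + 1) * Real.exp (-r ^ 2)) : ℝ) : ℂ))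
    (fun θ : ℝ => Complex.exp (((p - q : ℤ) : ℂ) * Complex.I * θ)), integral_Ioo_exp_int_mul]
  unfold gaussMoment
  by_cases hpq : p = q
  · rw [if_pos (by omega), if_pos hpq, integral_complex_ofReal, integral_const_mul, ← hpq, ← two_mul,
      integral_Ioi_pow_mul_exp_neg_sq]
    have := Real.pi_ne_zero
    have h2 : (Real.pi : ℂ) ≠ 0 := by exact_mod_cast this
    push_cast
    field_simp
    rfl
  · rw [if_neg (by omega), if_neg hpq]
    simp

end GaussianMoments

section Independence

variable {σ : Type} {Ω : Type*} [MeasurableSpace Ω] {P : Measure Ω}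

/-- The moments of the variables `X x`. -/
noncomputable def momentsOf (P : Measure Ω) (X : σ → Ω → ℝ) (x : σ) (k : ℕ) : ℂ :=
  ((∫ ω, X x ω ^ k ∂P : ℝ) : ℂ)

lemma AssumptionI.exists_normalizedMoments [IsProbabilityMeasure P] {X : σ → Ω → ℝ}
    (h : AssumptionI P X) : ∃ K, NormalizedMoments K (momentsOf P X) := by
  choose K hK using h.bounded_moments
  refine ⟨fun k => ∑ j ∈ Finset.range (k + 1), |K j|, ?_, ?_, ?_, ?_⟩
  · intro x; simp [momentsOf]
  · intro x; simp [momentsOf, h.mean_zero]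
  · intro x
    rw [momentsOf, ← variance_of_integral_eq_zero (h.measurable x).aemeasurable (h.mean_zero x),
      h.unit_variance, Complex.ofReal_one]
  · intro x j k hjk
    rw [momentsOf, Complex.norm_real]
    calc ‖∫ ω, X x ω ^ j ∂P‖ ≤ ∫ ω, |X x ω| ^ j ∂P := by
          refine (norm_integral_le_integral_norm _).trans (le_of_eq ?_)
          simp
      _ ≤ |K j| := (hK j x).2.trans (le_abs_self _)
      _ ≤ _ := Finset.single_le_sum (f := fun j => |K j|) (fun _ _ => abs_nonneg _)
          (Finset.mem_range.2 (by omega))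

lemma AssumptionI.integrable_pow {X : σ → Ω → ℝ} (h : AssumptionI P X) (x : σ) (k : ℕ) :
    Integrable (fun ω => ((X x ω : ℂ)) ^ k) P := by
  obtain ⟨K, hK⟩ := h.bounded_moments k
  refine ((hK x).1).mono' ?_ (ae_of_all _ fun ω => ?_)
  · exact ((Complex.measurable_ofReal.comp (h.measurable x)).pow_const k).aestronglyMeasurable
  · simp

lemma AssumptionI.integrable_prod_pow {X : σ → Ω → ℝ} (h : AssumptionI P X) (m : σ →₀ ℕ) :
    Integrable (fun ω => ∏ x ∈ m.support, (X x ω : ℂ) ^ m x) P := by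
  have hi : iIndepFun (fun x : m.support => X x) P := h.indep.precomp Subtype.val_injective
  have := hi.isProbabilityMeasure
  have hmeas : Measurable fun ω => fun x : m.support => X x ω :=
    measurable_pi_lambda _ fun x => h.measurable x
  have h1 := hi.map_fun_eq_pi_map fun x : m.support => (h.measurable x).aemeasurable
  have : ∀ x : m.support, IsProbabilityMeasure (P.map (X x)) :=
    fun x => Measure.isProbabilityMeasure_map (h.measurable x).aemeasurable
  have h2 : Integrable (fun y : m.support → ℝ => ∏ x : m.support, (y x : ℂ) ^ m x)
      (Measure.pi fun x : m.support => P.map (X x)) := by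
    refine Integrable.fintype_prod (f := fun (x : m.support) (y : ℝ) => (y : ℂ) ^ m x) fun x => ?_
    rw [integrable_map_measure (by fun_prop) (h.measurable x).aemeasurable]
    exact h.integrable_pow x _
  have hc : Continuous fun y : m.support → ℝ => ∏ x : m.support, (y x : ℂ) ^ m x :=
    continuous_finsetProd _ fun x _ => (Complex.continuous_ofReal.comp (continuous_apply x)).pow _
  rw [← h1, integrable_map_measure hc.aestronglyMeasurable hmeas.aemeasurable] at h2
  refine h2.congr (ae_of_all _ fun ω => ?_)
  exact Finset.prod_coe_sort m.support fun x => (X x ω : ℂ) ^ m x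

lemma AssumptionI.integral_prod_pow {X : σ → Ω → ℝ} (h : AssumptionI P X) (m : σ →₀ ℕ) :
    ∫ ω, ∏ x ∈ m.support, (X x ω : ℂ) ^ m x ∂P = m.prod (momentsOf P X) := by
  have hi : iIndepFun (fun x : m.support => X x) P := h.indep.precomp Subtype.val_injective
  have h1 := hi.integral_fun_prod_comp (𝕜 := ℂ)
    (f := fun (x : m.support) (y : ℝ) => (y : ℂ) ^ m x)
    (fun x : m.support => (h.measurable x).aemeasurable) (fun x => by fun_prop)
  rw [Finsupp.prod, ← Finset.prod_coe_sort]
  refine Eq.trans ?_ (h1.trans ?_)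
  · refine integral_congr_ae (ae_of_all _ fun ω => ?_)
    exact (Finset.prod_coe_sort m.support fun x => (X x ω : ℂ) ^ m x).symm
  · refine Finset.prod_congr rfl fun x _ => ?_
    rw [momentsOf, ← integral_complex_ofReal]
    simp

lemma AssumptionI.integrable_eval {X : σ → Ω → ℝ} (h : AssumptionI P X) (p : MvPolynomial σ ℂ) :
    Integrable (fun ω => MvPolynomial.eval (fun x => (X x ω : ℂ)) p) P := by
  simp only [MvPolynomial.eval_eq]
  exact integrable_finsetSum _ fun m _ => (h.integrable_prod_pow m).const_mul _

lemma AssumptionI.integral_eval {X : σ → Ω → ℝ} (h : AssumptionI P X) (p : MvPolynomial σ ℂ) :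
    ∫ ω, MvPolynomial.eval (fun x => (X x ω : ℂ)) p ∂P = momentFunctional (momentsOf P X) p := by
  simp only [MvPolynomial.eval_eq]
  rw [integral_finsetSum _ fun m _ => (h.integrable_prod_pow m).const_mul _,
    momentFunctional_eq_sum]
  refine Finset.sum_congr rfl fun m _ => ?_
  rw [integral_const_mul, h.integral_prod_pow]

end Independence

section AsymptoticAlgebra

lemma mem_span_starWord_of_mem_adjoin {ι B : Type*} [Ring B] [StarRing B] [Algebra ℂ B]
    [StarModule ℂ B] (a : ι → B) {x : B} (hx : x ∈ StarAlgebra.adjoin ℂ (Set.range a)) :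
    x ∈ Submodule.span ℂ (Set.range (starWord a)) := by
  have h1 : x ∈ Algebra.adjoin ℂ (Set.range a ∪ star (Set.range a)) := hx
  rw [← Subalgebra.mem_toSubmodule, Algebra.adjoin_eq_span] at h1
  refine Submodule.span_mono ?_ h1
  intro y hy
  obtain ⟨l, hl, rfl⟩ := Submonoid.exists_list_of_mem_closure hy
  clear hy h1 hx
  induction l with
  | nil => exact ⟨[], by simp [starWord]⟩
  | cons z l ih =>
    obtain ⟨w, hw⟩ := ih fun y hy => hl y (List.mem_cons_of_mem _ hy)
    rcases hl z (by simp) with ⟨i, rfl⟩ | hz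
    · exact ⟨(i, false) :: w, by rw [List.prod_cons, ← hw]; simp [starWord]⟩
    · obtain ⟨i, hi⟩ := Set.mem_star.1 hz
      refine ⟨(i, true) :: w, ?_⟩
      rw [List.prod_cons, ← hw]
      simp [starWord, hi]

variable {ι Ω : Type} [MeasurableSpace Ω]

/-- The sequences of random matrices with integrable trace whose normalised expected trace
converges. -/
def traceConvergent (P : Measure Ω) : Submodule ℂ (∀ n : ℕ, Ω → Matrix (Fin n) (Fin n) ℂ) where
  carrier := {a | (∀ n, Integrable (fun ω => (a n ω).trace) P) ∧
    ∃ ℓ, Tendsto (fun n => expectedTrace P n (a n)) atTop (𝓝 ℓ)}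
  add_mem' := by
    rintro a b ⟨ha, ℓ, hℓ⟩ ⟨hb, ℓ', hℓ'⟩
    refine ⟨fun n => by simpa [Matrix.trace_add] using! (ha n).add (hb n), ℓ + ℓ', (hℓ.add hℓ').congr fun n => ?_⟩
    simp only [expectedTrace, Pi.add_apply, Matrix.trace_add]
    rw [integral_add (ha n) (hb n), mul_add]
  zero_mem' := ⟨fun n => by simp, 0, by simp [expectedTrace]⟩
  smul_mem' := by
    rintro z a ⟨ha, ℓ, hℓ⟩
    refine ⟨fun n => by simpa using (ha n).const_mul z, z * ℓ, (hℓ.const_mul z).congr fun n => ?_⟩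
    simp only [expectedTrace, Pi.smul_apply, Matrix.trace_smul, smul_eq_mul, integral_const_mul]
    ring

/-- The limit of the normalised expected traces. -/
noncomputable def limitTrace (P : Measure Ω) : traceConvergent P →ₗ[ℂ] ℂ where
  toFun a := a.2.2.choose
  map_add' a b := by
    refine tendsto_nhds_unique (a + b).2.2.choose_spec
      ((a.2.2.choose_spec.add b.2.2.choose_spec).congr fun n => ?_)
    simp only [expectedTrace, Submodule.coe_add, Pi.add_apply, Matrix.trace_add]
    rw [integral_add (a.2.1 n) (b.2.1 n), mul_add]
  map_smul' z a := by
    refine tendsto_nhds_unique (z • a).2.2.choose_spec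
      ((a.2.2.choose_spec.const_mul z).congr fun n => ?_)
    simp only [expectedTrace, Submodule.coe_smul, Pi.smul_apply, Matrix.trace_smul, smul_eq_mul,
      integral_const_mul]
    ring

lemma tendsto_limitTrace (P : Measure Ω) (a : traceConvergent P) :
    Tendsto (fun n => expectedTrace P n (a.1 n)) atTop (𝓝 (limitTrace P a)) :=
  a.2.2.choose_spec

lemma expectedTrace_star_mul_self (P : Measure Ω) (n : ℕ) (M : Ω → Matrix (Fin n) (Fin n) ℂ) :
    0 ≤ (expectedTrace P n (star M * M)).re ∧ (expectedTrace P n (star M * M)).im = 0 := by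
  have h : ∀ ω, ((star M * M) ω).trace =
      ((∑ i : Fin n, ∑ j : Fin n, ‖M ω j i‖ ^ 2 : ℝ) : ℂ) := by
    intro ω
    push_cast
    rw [Matrix.trace]
    refine Finset.sum_congr rfl fun i _ => ?_
    rw [Matrix.diag_apply, Pi.mul_apply, Matrix.mul_apply]
    refine Finset.sum_congr rfl fun j _ => ?_
    rw [Pi.star_apply, Matrix.star_apply, Complex.star_def, Complex.conj_mul']
  have h2 : expectedTrace P n (star M * M) =
      (((n : ℝ)⁻¹ * ∫ ω, ∑ i : Fin n, ∑ j : Fin n, ‖M ω j i‖ ^ 2 ∂P : ℝ) : ℂ) := by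
    simp only [expectedTrace, h]
    rw [integral_complex_ofReal]
    push_cast
    rfl
  rw [h2, Complex.ofReal_re, Complex.ofReal_im]
  refine ⟨mul_nonneg (by positivity) (integral_nonneg fun ω => ?_), rfl⟩
  positivity

/-- A family of sequences of random matrices whose joint `*`-moments converge has a limit in a
`*`-probability space, in which the relations between the matrices persist. -/
theorem exists_starProbSpace_limit (P : Measure Ω) [IsProbabilityMeasure P]
    (a : ι → ∀ n : ℕ, Ω → Matrix (Fin n) (Fin n) ℂ)
    (h : ∀ w, starWord a w ∈ traceConvergent P) :
    ∃ (𝒜 : StarProbSpace) (b : ι → 𝒜.carrier),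
      (∀ w, Tendsto (fun n => expectedTrace P n (starWord a w n)) atTop
        (𝓝 (𝒜.state (starWord b w)))) ∧
      (∀ i j, Commute (a i) (a j) → Commute (b i) (b j)) ∧
      (∀ i j, Commute (a i) (star (a j)) → Commute (b i) (star (b j))) ∧
      (∀ i, a i ∈ unitary _ → b i ∈ unitary _) := by
  set A := StarAlgebra.adjoin ℂ (Set.range a) with hA
  have hsub : ∀ x ∈ A, x ∈ traceConvergent P := fun x hx => by
    refine (Submodule.span_le (p := traceConvergent P)).2 ?_ (mem_span_starWord_of_mem_adjoin a hx)
    rintro _ ⟨w, rfl⟩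
    exact h w
  let toConv : A →ₗ[ℂ] traceConvergent P :=
    { toFun := fun x => ⟨x.1, hsub x.1 x.2⟩
      map_add' := fun _ _ => rfl
      map_smul' := fun _ _ => rfl }
  have hlim : ∀ x : A, Tendsto (fun n => expectedTrace P n (x.1 n)) atTop
      (𝓝 ((limitTrace P ∘ₗ toConv) x)) := fun x => tendsto_limitTrace P (toConv x)
  let 𝒜 : StarProbSpace :=
    { carrier := A
      state := limitTrace P ∘ₗ toConv
      state_one := by
        refine tendsto_nhds_unique (hlim 1) (tendsto_const_nhds.congr' ?_)
        filter_upwards [eventually_gt_atTop 0] with n hn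
        have : (n : ℂ) ≠ 0 := by exact_mod_cast hn.ne'
        simp [expectedTrace, this]
      state_nonneg := fun x => by
        have hx := hlim (star x * x)
        refine ⟨ge_of_tendsto' ((Complex.continuous_re.tendsto _).comp hx)
          fun n => (expectedTrace_star_mul_self P n (x.1 n)).1, ?_⟩
        refine tendsto_nhds_unique ((Complex.continuous_im.tendsto _).comp hx)
          (tendsto_const_nhds.congr fun n => ?_)
        exact (expectedTrace_star_mul_self P n (x.1 n)).2.symm }
  let b : ι → 𝒜.carrier := fun i => (⟨a i, StarAlgebra.subset_adjoin ℂ _ ⟨i, rfl⟩⟩ : A)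
  have hb : ∀ w, ((starWord b w : A) : ∀ n : ℕ, Ω → Matrix (Fin n) (Fin n) ℂ) = starWord a w := by
    intro w
    induction w with
    | nil => rfl
    | cons x w ih =>
      have e1 : starWord a (x :: w) = (if x.2 then star (a x.1) else a x.1) * starWord a w := by
        simp [starWord]
      have e2 : (starWord b (x :: w) : A) =
          (if x.2 then star (b x.1) else b x.1 : A) * (starWord b w : A) := by
        simp [starWord]
      rw [e1, e2, ← ih]
      cases x.2 <;> rfl
  refine ⟨𝒜, b, fun w => ?_, fun i j hij => Subtype.ext hij, fun i j hij => Subtype.ext hij,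
    fun i hi => ?_⟩
  · rw [← hb w]
    exact hlim (starWord b w : A)
  · exact ⟨Subtype.ext hi.1, Subtype.ext hi.2⟩

end AsymptoticAlgebra

section CirculantMatrices

lemma circ_eq_circulant (n : ℕ) (c : ℕ → ℂ) :
    circ n c = Matrix.circulant fun d : Fin n => c ((n - (d : ℕ)) % n) := by
  ext i j
  have hi := i.2
  have hj := j.2
  simp only [circ, Matrix.of_apply, Matrix.circulant_apply, Fin.sub_def]
  congr 1
  rcases le_or_gt (j : ℕ) i with h | h
  · have h1 : (n - (j : ℕ) + i) % n = i - j := by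
      rw [show n - (j : ℕ) + i = (i - j) + n by omega, Nat.add_mod_right]
      exact Nat.mod_eq_of_lt (by omega)
    rw [h1]
    congr 1
    omega
  · have h1 : (n - (j : ℕ) + i) % n = n - j + i := Nat.mod_eq_of_lt (by omega)
    rw [h1, show (j : ℕ) + n - i = (j - i) + n by omega, Nat.add_mod_right]
    congr 1
    omega

lemma commute_circ (n : ℕ) (c c' : ℕ → ℂ) : Commute (circ n c) (circ n c') := by
  rw [circ_eq_circulant, circ_eq_circulant]
  exact Matrix.Fin.circulant_mul_comm _ _

lemma commute_circ_star (n : ℕ) (c c' : ℕ → ℂ) : Commute (circ n c) (star (circ n c')) := by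
  rw [circ_eq_circulant, circ_eq_circulant, Matrix.star_eq_conjTranspose,
    Matrix.Fin.conjTranspose_circulant]
  exact Matrix.Fin.circulant_mul_comm _ _

lemma diagD_eq (θ : ℝ) (n : ℕ) : diagD θ n = Matrix.diagonal fun j : Fin n => diagSymbol θ n j := rfl

lemma diagSymbol_mul_star (θ : ℝ) (n j : ℕ) : diagSymbol θ n j * star (diagSymbol θ n j) = 1 := by
  rw [Complex.star_def, Complex.mul_conj', norm_diagSymbol]
  simp

lemma star_diagD (θ : ℝ) (n : ℕ) :
    star (diagD θ n) = Matrix.diagonal fun j : Fin n => star (diagSymbol θ n j) := by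
  rw [diagD_eq, Matrix.star_eq_conjTranspose, Matrix.diagonal_conjTranspose]
  rfl

lemma diagD_mem_unitary (θ : ℝ) (n : ℕ) : diagD θ n ∈ unitary (Matrix (Fin n) (Fin n) ℂ) := by
  refine Unitary.mem_iff.2 ⟨?_, ?_⟩
  · rw [star_diagD, diagD_eq, Matrix.diagonal_mul_diagonal, ← Matrix.diagonal_one]
    congr 1
    funext j
    rw [mul_comm, diagSymbol_mul_star]
  · rw [star_diagD, diagD_eq, Matrix.diagonal_mul_diagonal, ← Matrix.diagonal_one]
    congr 1
    funext j
    rw [diagSymbol_mul_star]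

end CirculantMatrices

section RandomWords

variable {k : ℕ} {Ω : Type*}

/-- The family of all matrices in the theorem. -/
noncomputable def matrixFamily (θ τ : ℝ) (c ct : Fin k → ℕ → Ω → ℝ) (n : ℕ) :
    Fin k ⊕ (Fin k ⊕ Unit) → Ω → Matrix (Fin n) (Fin n) ℂ :=
  Sum.elim (fun j => scaledCirc (c j) n)
    (Sum.elim (fun j => scaledTwistedCirc τ (ct j) n) (fun _ : Unit => fun _ => diagD θ n))

/-- The phases of the plain and the twisted circulants. -/
noncomputable def twistPhase (k : ℕ) (τ : ℝ) (n : ℕ) : Fin k ⊕ Fin k → ℕ → ℂ :=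
  Sum.elim (fun _ _ => 1) (fun _ i => eta τ n ^ i)

lemma norm_twistPhase (τ : ℝ) (n : ℕ) (r : Fin k ⊕ Fin k) (i : ℕ) : ‖twistPhase k τ n r i‖ = 1 := by
  rcases r with r | r <;> simp [twistPhase, norm_eta]

/-- The matrix letter of a letter of a `*`-monomial. -/
noncomputable def letterOf (θ : ℝ) :
    (Fin k ⊕ (Fin k ⊕ Unit)) × Bool → MatrixLetter (Fin k ⊕ Fin k)
  | (.inl j, b) => .inl (.inl j, b)
  | (.inr (.inl j), b) => .inl (.inr j, b)
  | (.inr (.inr _), b) => .inr (diagSymbol (if b then -θ else θ))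

lemma approximableSymbol_of_mem_map_letterOf (θ : ℝ) (w : List ((Fin k ⊕ (Fin k ⊕ Unit)) × Bool))
    (f : ℕ → ℕ → ℂ) (hf : Sum.inr f ∈ w.map (letterOf θ)) : ApproximableSymbol f := by
  obtain ⟨⟨x, b⟩, _, hx⟩ := List.mem_map.1 hf
  rcases x with j | j | u
  · simp [letterOf] at hx
  · simp [letterOf] at hx
  · simp only [letterOf, Sum.inr.injEq] at hx
    rw [← hx]
    exact approximableSymbol_diagSymbol _

lemma letterMatrix_map_eval (θ τ : ℝ) (c ct : Fin k → ℕ → Ω → ℝ) (n : ℕ) (ω : Ω)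
    (x : (Fin k ⊕ (Fin k ⊕ Unit)) × Bool) :
    (letterMatrix n (twistPhase k τ n) (letterOf θ x)).map
        (MvPolynomial.eval fun y => (Sum.elim c ct y.1 y.2 ω : ℂ)) =
      (if x.2 then star (matrixFamily θ τ c ct n x.1) else matrixFamily θ τ c ct n x.1) ω := by
  obtain ⟨x, b⟩ := x
  ext i j
  rcases x with r | r | u
  · cases b
    · simp [letterMatrix, letterOf, matrixFamily, scaledCirc, circ, twistPhase, starIf, circIndex]
    · simp [letterMatrix, letterOf, matrixFamily, scaledCirc, circ, twistPhase, starIf, circIndex]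
  · cases b
    · simp [letterMatrix, letterOf, matrixFamily, scaledTwistedCirc, circ, twistPhase, starIf,
        circIndex]
      ring
    · simp [letterMatrix, letterOf, matrixFamily, scaledTwistedCirc, circ, twistPhase, starIf,
        circIndex]
      ring
  · cases b
    · simp only [letterMatrix, letterOf, matrixFamily, Bool.false_eq_true, if_false, Sum.elim_inr,
        Matrix.map_apply, diagD_eq, Matrix.diagonal_apply]
      split_ifs <;> simp
    · simp only [letterMatrix, letterOf, matrixFamily, if_true, Sum.elim_inr,
        Matrix.map_apply, Pi.star_apply, star_diagD, Matrix.diagonal_apply, star_diagSymbol]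
      split_ifs <;> simp

lemma wordMatrix_map_eval (θ τ : ℝ) (c ct : Fin k → ℕ → Ω → ℝ) (n : ℕ) (ω : Ω)
    (w : List ((Fin k ⊕ (Fin k ⊕ Unit)) × Bool)) :
    (wordMatrix n (twistPhase k τ n) (w.map (letterOf θ))).map
        (MvPolynomial.eval fun y => (Sum.elim c ct y.1 y.2 ω : ℂ)) =
      starWord (matrixFamily θ τ c ct n) w ω := by
  induction w with
  | nil =>
    simp only [wordMatrix, starWord, List.map_nil, List.prod_nil, Pi.one_apply]
    exact Matrix.map_one _ (map_zero _) (map_one _)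
  | cons x w ih =>
    have h1 : starWord (matrixFamily θ τ c ct n) (x :: w) =
        (if x.2 then star (matrixFamily θ τ c ct n x.1) else matrixFamily θ τ c ct n x.1) *
          starWord (matrixFamily θ τ c ct n) w := by
      simp [starWord]
    rw [h1, Pi.mul_apply, ← ih, ← letterMatrix_map_eval, List.map_cons, wordMatrix_cons,
      Matrix.map_mul]

lemma trace_starWord (θ τ : ℝ) (c ct : Fin k → ℕ → Ω → ℝ) (n : ℕ) (ω : Ω)
    (w : List ((Fin k ⊕ (Fin k ⊕ Unit)) × Bool)) :
    (starWord (matrixFamily θ τ c ct n) w ω).trace =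
      MvPolynomial.eval (fun y => (Sum.elim c ct y.1 y.2 ω : ℂ))
        (wordMatrix n (twistPhase k τ n) (w.map (letterOf θ))).trace := by
  rw [← wordMatrix_map_eval, Matrix.trace, Matrix.trace, map_sum]
  rfl

variable [MeasurableSpace Ω] {P : Measure Ω}

lemma integrable_trace_starWord (θ τ : ℝ) {c ct : Fin k → ℕ → Ω → ℝ}
    (h : AssumptionI P (fun x : (Fin k ⊕ Fin k) × ℕ => Sum.elim c ct x.1 x.2)) (n : ℕ)
    (w : List ((Fin k ⊕ (Fin k ⊕ Unit)) × Bool)) :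
    Integrable (fun ω => (starWord (matrixFamily θ τ c ct n) w ω).trace) P := by
  simp only [trace_starWord]
  exact h.integrable_eval _

lemma expectedTrace_starWord (θ τ : ℝ) {c ct : Fin k → ℕ → Ω → ℝ}
    (h : AssumptionI P (fun x : (Fin k ⊕ Fin k) × ℕ => Sum.elim c ct x.1 x.2)) (n : ℕ)
    (w : List ((Fin k ⊕ (Fin k ⊕ Unit)) × Bool)) :
    expectedTrace P n (starWord (matrixFamily θ τ c ct n) w) =
      wordMean n (momentsOf P fun x : (Fin k ⊕ Fin k) × ℕ => Sum.elim c ct x.1 x.2)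
        (twistPhase k τ n) (w.map (letterOf θ)) := by
  simp only [expectedTrace, wordMean, trace_starWord]
  rw [← h.integral_eval]

end RandomWords

section GaussianModel

variable {σ : Type}

lemma assumptionI_infinitePi_gaussianReal :
    AssumptionI (Measure.infinitePi fun _ : σ => gaussianReal 0 1)
      (fun (x : σ) (ω : σ → ℝ) => ω x) := by
  have hmap : ∀ x : σ, (Measure.infinitePi fun _ : σ => gaussianReal 0 1).map (fun ω => ω x) =
      gaussianReal 0 1 := fun x => Measure.infinitePi_map_eval _ x
  have hmp : ∀ x : σ, AEMeasurable (fun ω : σ → ℝ => ω x)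
      (Measure.infinitePi fun _ : σ => gaussianReal 0 1) :=
    fun x => (measurable_pi_apply x).aemeasurable
  refine ⟨fun x => measurable_pi_apply x, ?_, fun x => ?_, fun x => ?_, fun p => ?_⟩
  · exact iIndepFun_infinitePi (X := fun _ y => y) fun _ => measurable_id
  · have := integral_map (hmp x) (f := fun y : ℝ => y) (by fun_prop)
    rw [← this, hmap, integral_id_gaussianReal]
  · have := variance_map (X := id) (Y := fun ω : σ → ℝ => ω x) (by fun_prop) (hmp x)
    rw [hmap, variance_id_gaussianReal] at this
    simpa using this.symm
  · refine ⟨∫ y, |y| ^ p ∂gaussianReal 0 1, fun x => ⟨?_, ?_⟩⟩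
    · have h1 : Integrable (fun y : ℝ => |y| ^ p) (gaussianReal 0 1) := by
        have := (memLp_id_gaussianReal (μ := 0) (v := 1) p).integrable_norm_pow'
        simpa using this
      rw [← hmap x, integrable_map_measure (by fun_prop) (hmp x)] at h1
      exact h1
    · have := integral_map (hmp x) (f := fun y : ℝ => |y| ^ p) (by fun_prop)
      rw [hmap] at this
      exact this.symm.le

end GaussianModel

section CirculantWords

variable {κ : Type} [DecidableEq κ]

/-- The word `∏ a_i^{p_i} (a_i^*)^{q_i}` over the list `l`, with `p i = e i false` and
`q i = e i true`. -/
def normalWord (e : κ → Bool → ℕ) (l : List κ) : List (κ × Bool) :=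
  l.flatMap fun i => List.replicate (e i false) (i, false) ++ List.replicate (e i true) (i, true)

omit [DecidableEq κ] in
lemma starWord_normalWord {A ι : Type*} [Monoid A] [Star A] (a : ι → A) (f : κ → ι)
    (e : κ → Bool → ℕ) (l : List κ) :
    starWord a ((normalWord e l).map fun x => (f x.1, x.2)) =
      (l.map fun i => a (f i) ^ e i false * star (a (f i)) ^ e i true).prod := by
  induction l with
  | nil => simp [normalWord, starWord]
  | cons i l ih =>
    rw [List.map_cons, List.prod_cons, ← ih]
    simp [normalWord, starWord, mul_assoc]

lemma count_normalWord (e : κ → Bool → ℕ) {l : List κ} (hl : l.Nodup) (i : κ) (b : Bool) :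
    (normalWord e l).count (i, b) = if i ∈ l then e i b else 0 := by
  induction l with
  | nil => simp [normalWord]
  | cons j l ih =>
    have h1 : normalWord e (j :: l) = List.replicate (e j false) (j, false) ++
        List.replicate (e j true) (j, true) ++ normalWord e l := rfl
    rw [h1, List.count_append, ih hl.of_cons, List.count_append, List.count_replicate,
      List.count_replicate]
    have hj := (List.nodup_cons.1 hl).1
    by_cases hij : i = j
    · subst hij
      cases b <;> simp [hj]
    · have : j ≠ i := fun h => hij h.symm
      simp [hij, this]

omit [DecidableEq κ] in
lemma clockShift_map_inl (w : List (κ × Bool)) : clockShift (w.map Sum.inl) = 0 := by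
  induction w with
  | nil => rfl
  | cons x w ih => exact ih

omit [DecidableEq κ] in
lemma clockLabels_map_inl (w : List (κ × Bool)) :
    clockLabels (w.map Sum.inl) = w.map fun x => ((x.1, (0 : ℤ)), x.2) := by
  induction w with
  | nil => rfl
  | cons x w ih =>
    rw [List.map_cons, List.map_cons, ← ih, ← clockShift_map_inl w]
    rfl

lemma labelCount_getElem {Λ : Type*} [DecidableEq Λ] (w : List (Λ × Bool)) (i : Λ) (b : Bool) :
    labelCount (fun j : Fin w.length => w[j]) Finset.univ i b = w.count (i, b) := by
  refine (Fin.card_filter_univ_eq_vector_get_eq_count (i, b) ⟨w, rfl⟩).trans ?_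
  congr 1
  exact lawful_beq_subsingleton _ _

lemma wickCount_normalWord (e : κ → Bool → ℕ) {l : List κ} (hl : l.Nodup) :
    wickCount (fun j : Fin (clockLabels ((normalWord e l).map Sum.inl)).length =>
      (clockLabels ((normalWord e l).map Sum.inl))[j]) Finset.univ =
        (l.map fun i => gaussMoment (e i)).prod := by
  have hinj : Function.Injective fun i : κ => (i, (0 : ℤ)) := fun i j h => (Prod.ext_iff.1 h).1
  have hinj2 : Function.Injective fun x : κ × Bool => ((x.1, (0 : ℤ)), x.2) := by
    rintro ⟨i, b⟩ ⟨j, b'⟩ h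
    simp only [Prod.mk.injEq, and_true] at h
    rw [h.1, h.2]
  rw [wickCount_eq_prod (U := l.toFinset.image fun i => (i, (0 : ℤ))),
    Finset.prod_image fun i _ j _ h => hinj h, List.prod_toFinset _ hl]
  · congr 1
    refine List.map_congr_left fun i hi => ?_
    congr 1
    funext b
    have h1 := List.count_map_of_injective (normalWord e l) _ hinj2 (i, b)
    rw [labelCount_getElem, clockLabels_map_inl]
    rw [count_normalWord e hl, if_pos hi] at h1
    refine Eq.trans ?_ h1
    congr 1
    exact lawful_beq_subsingleton _ _
  · intro j _
    have hmem : ∀ y ∈ clockLabels ((normalWord e l).map Sum.inl),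
        y.1 ∈ l.toFinset.image fun i => (i, (0 : ℤ)) := by
      intro y hy
      rw [clockLabels_map_inl] at hy
      obtain ⟨x, hx, rfl⟩ := List.mem_map.1 hy
      refine Finset.mem_image.2 ⟨x.1, ?_, rfl⟩
      obtain ⟨i, hi, hxi⟩ := List.mem_flatMap.1 hx
      rcases List.mem_append.1 hxi with h | h <;> rw [List.eq_of_mem_replicate h] <;> simpa using hi
    exact hmem _ (List.getElem_mem _)

end CirculantWords

lemma integral_pow_mul_star_pow_expUniformLaw (θ : ℝ) (p q : ℕ) :
    ∫ z, z ^ p * star z ^ q ∂expUniformLaw θ =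
      ∫ u in (0 : ℝ)..1, Complex.exp (Complex.I * (θ * (p - q) : ℝ) * u) := by
  rw [expUniformLaw, integral_map (by fun_prop) (by fun_prop),
    intervalIntegral.integral_of_le zero_le_one, integral_Ioc_eq_integral_Ioo]
  refine setIntegral_congr_fun measurableSet_Ioo fun u _ => ?_
  rw [Complex.star_def, ← Complex.exp_conj, ← Complex.exp_nat_mul, ← Complex.exp_nat_mul,
    ← Complex.exp_add]
  congr 1
  simp only [map_mul, Complex.conj_I, Complex.conj_ofReal]
  push_cast
  ring

lemma diagD_pow_mul_star_pow (θ : ℝ) (n p q : ℕ) :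
    diagD θ n ^ p * star (diagD θ n) ^ q =
      Matrix.diagonal fun j : Fin n => diagSymbol (θ * (p - q)) n j := by
  rw [star_diagD, diagD_eq, Matrix.diagonal_pow, Matrix.diagonal_pow, Matrix.diagonal_mul_diagonal]
  congr 1
  funext j
  rw [Pi.pow_apply, Pi.pow_apply, star_diagSymbol, diagSymbol_eq, diagSymbol_eq, diagSymbol_eq,
    ← Complex.exp_nat_mul, ← Complex.exp_nat_mul, ← Complex.exp_add]
  congr 1
  push_cast
  ring

lemma starWord_replicate {ι A : Type*} [Monoid A] [Star A] (a : ι → A) (i : ι) (p q : ℕ) :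
    starWord a (List.replicate p (i, false) ++ List.replicate q (i, true)) =
      a i ^ p * star (a i) ^ q := by
  simp [starWord]

theorem theorem2p2 (k : ℕ) (θ : ℝ) (hθ : θ ∈ Set.Icc (-Real.pi) Real.pi) :
    ∃ (𝒜 : StarProbSpace) (N Nt : Fin k → 𝒜.carrier) (d : 𝒜.carrier),
      (∀ j, HasStarLaw 𝒜.state (N j) stdComplexGaussian) ∧
      (∀ j, HasStarLaw 𝒜.state (Nt j) stdComplexGaussian) ∧
      IndepVariables 𝒜.state (Sum.elim N Nt) ∧
      d ∈ unitary 𝒜.carrier ∧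
      HasStarLaw 𝒜.state d (expUniformLaw θ) ∧
      ∀ (τ : ℝ), τ ∈ Set.Icc (-Real.pi) Real.pi →
        ∀ {Ω : Type*} [MeasurableSpace Ω] (P : Measure Ω) [IsProbabilityMeasure P]
          (c ct : Fin k → ℕ → Ω → ℝ),
          AssumptionI P (fun x : (Fin k ⊕ Fin k) × ℕ => Sum.elim c ct x.1 x.2) →
          ConvergesInStarDistribution
            (B := fun n => Ω → Matrix (Fin n) (Fin n) ℂ)
            (expectedTrace P)
            (fun n => Sum.elim (fun j => scaledCirc (c j) n)
              (Sum.elim (fun j => scaledTwistedCirc τ (ct j) n)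
                (fun _ : Unit => fun _ => diagD θ n)))
            𝒜.state
            (Sum.elim N (Sum.elim Nt (fun _ : Unit => d))) := by
  set Ω₀ := (Fin k ⊕ Fin k) × ℕ → ℝ
  set P₀ : Measure Ω₀ := Measure.infinitePi fun _ => gaussianReal 0 1
  set c₀ : Fin k → ℕ → Ω₀ → ℝ := fun j i ω => ω (.inl j, i) with hc₀
  set ct₀ : Fin k → ℕ → Ω₀ → ℝ := fun j i ω => ω (.inr j, i) with hct₀
  have hA₀ : AssumptionI P₀ (fun x : (Fin k ⊕ Fin k) × ℕ => Sum.elim c₀ ct₀ x.1 x.2) := by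
    convert assumptionI_infinitePi_gaussianReal (σ := (Fin k ⊕ Fin k) × ℕ) using 1
    funext x ω
    rcases x with ⟨r | r, i⟩ <;> rfl
  obtain ⟨K₀, hK₀⟩ := hA₀.exists_normalizedMoments
  set a : Fin k ⊕ (Fin k ⊕ Unit) → ∀ n : ℕ, Ω₀ → Matrix (Fin n) (Fin n) ℂ :=
    fun x n => matrixFamily θ 0 c₀ ct₀ n x with ha
  have hword : ∀ w n, starWord a w n = starWord (matrixFamily θ 0 c₀ ct₀ n) w := by
    intro w n
    induction w with
    | nil => rfl
    | cons x w ih =>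
      have e1 : starWord a (x :: w) = (if x.2 then star (a x.1) else a x.1) * starWord a w := by
        simp [starWord]
      have e2 : starWord (matrixFamily θ 0 c₀ ct₀ n) (x :: w) =
          (if x.2 then star (matrixFamily θ 0 c₀ ct₀ n x.1) else matrixFamily θ 0 c₀ ct₀ n x.1) *
            starWord (matrixFamily θ 0 c₀ ct₀ n) w := by
        simp [starWord]
      rw [e1, e2, Pi.mul_apply, ih]
      cases x.2 <;> rfl
  have hmean : ∀ w n, expectedTrace P₀ n (starWord a w n) =
      wordMean n (momentsOf P₀ fun x : (Fin k ⊕ Fin k) × ℕ => Sum.elim c₀ ct₀ x.1 x.2)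
        (twistPhase k 0 n) (w.map (letterOf θ)) := fun w n => by
    rw [hword, expectedTrace_starWord θ 0 hA₀]
  have hconv : ∀ w, starWord a w ∈ traceConvergent P₀ := by
    intro w
    refine ⟨fun n => ?_, ?_⟩
    · rw [hword]
      exact integrable_trace_starWord θ 0 hA₀ n w
    · simp only [hmean]
      exact exists_tendsto_wordMean (fun _ => hK₀) (fun n => norm_twistPhase 0 n) _
        (approximableSymbol_of_mem_map_letterOf θ w)
  obtain ⟨𝒜, b, hlim, hcomm, hcommStar, hunit⟩ := exists_starProbSpace_limit P₀ a hconv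
  set emb : Fin k ⊕ Fin k → Fin k ⊕ (Fin k ⊕ Unit) := Sum.map id Sum.inl with hemb
  have hcirc : ∀ r : Fin k ⊕ Fin k, ∀ n ω, ∃ (z : ℂ) (f : ℕ → ℂ), a (emb r) n ω = z • circ n f := by
    rintro (r | r) n ω
    · exact ⟨_, _, rfl⟩
    · exact ⟨_, _, rfl⟩
  have hab : ∀ r s, Commute (b (emb r)) (b (emb s)) := by
    refine fun r s => hcomm _ _ (funext fun n => funext fun ω => ?_)
    obtain ⟨z, f, hf⟩ := hcirc r n ω
    obtain ⟨z', f', hf'⟩ := hcirc s n ω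
    simp only [Pi.mul_apply, hf, hf']
    exact ((commute_circ n f f').smul_left z).smul_right z'
  have habStar : ∀ r s, Commute (b (emb r)) (star (b (emb s))) := by
    refine fun r s => hcommStar _ _ (funext fun n => funext fun ω => ?_)
    obtain ⟨z, f, hf⟩ := hcirc r n ω
    obtain ⟨z', f', hf'⟩ := hcirc s n ω
    simp only [Pi.mul_apply, Pi.star_apply, hf, hf', star_smul]
    exact ((commute_circ_star n f f').smul_left z).smul_right _
  have hmoment : ∀ (e : Fin k ⊕ Fin k → Bool → ℕ) (l : List (Fin k ⊕ Fin k)), l.Nodup →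
      𝒜.state (l.map fun i => b (emb i) ^ e i false * star (b (emb i)) ^ e i true).prod =
        ((l.map fun i => gaussMoment (e i)).prod : ℕ) := by
    intro e l hl
    rw [← starWord_normalWord b emb e l, ← wickCount_normalWord e hl]
    refine tendsto_nhds_unique (hlim _) ?_
    simp only [hmean]
    have h1 : ((normalWord e l).map fun x => (emb x.1, x.2)).map (letterOf θ) =
        clockLetters ((normalWord e l).map Sum.inl) := by
      rw [clockLetters, List.map_map, List.map_map]
      refine List.map_congr_left ?_
      rintro ⟨r | r, β⟩ _ <;> rfl
    rw [h1]
    have h2 := tendsto_wordMean_clockWord (fun _ : ℕ => hK₀) (fun n => norm_twistPhase 0 n)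
      ((normalWord e l).map Sum.inl)
    rwa [if_pos (clockShift_map_inl _)] at h2
  have hlaw : ∀ r, HasStarLaw 𝒜.state (b (emb r)) stdComplexGaussian := by
    refine fun r => ⟨habStar r r, fun p q => ?_⟩
    have h1 := hmoment (fun _ β => if β then q else p) [r] (List.nodup_singleton r)
    have h2 := integral_pow_mul_star_pow_stdComplexGaussian fun β => if β then q else p
    simp only [List.map_cons, List.map_nil, List.prod_cons, List.prod_nil, mul_one, if_true,
      Bool.false_eq_true, if_false] at h1 h2
    rw [h1, h2]
  have helim : Sum.elim (fun j => b (.inl j)) (fun j => b (.inr (.inl j))) = fun r => b (emb r) := by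
    funext r
    rcases r with r | r <;> rfl
  have hd : b (.inr (.inr ())) ∈ unitary 𝒜.carrier := by
    refine hunit _ ⟨?_, ?_⟩
    · funext n ω
      exact (diagD_mem_unitary θ n).1
    · funext n ω
      exact (diagD_mem_unitary θ n).2
  refine ⟨𝒜, fun j => b (.inl j), fun j => b (.inr (.inl j)), b (.inr (.inr ())),
    fun j => hlaw (.inl j), fun j => hlaw (.inr j), ?_, hd, ?_, ?_⟩
  · rw [helim]
    refine ⟨fun r s _ => ⟨hab r s, habStar r s⟩, fun p q l hl => ?_⟩
    have h1 := hmoment (fun r β => if β then q r else p r) l hl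
    simp only [if_true, Bool.false_eq_true, if_false] at h1
    rw [h1, Nat.cast_list_prod, List.map_map]
    congr 1
    refine List.map_congr_left fun r _ => ?_
    have h2 := hmoment (fun r β => if β then q r else p r) [r] (List.nodup_singleton r)
    simp only [List.map_cons, List.map_nil, List.prod_cons, List.prod_nil, mul_one, if_true,
      Bool.false_eq_true, if_false] at h2
    exact h2.symm
  · refine ⟨((Unitary.mem_iff.1 hd).2).trans ((Unitary.mem_iff.1 hd).1).symm, fun p q => ?_⟩
    rw [← starWord_replicate b, integral_pow_mul_star_pow_expUniformLaw]
    refine tendsto_nhds_unique (hlim _) ((tendsto_mean_diagSymbol (θ * (p - q))).congr fun n => ?_)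
    have h1 : ∀ ω, (starWord a (List.replicate p (Sum.inr (Sum.inr ()), false) ++
        List.replicate q (Sum.inr (Sum.inr ()), true)) n ω) =
        diagD θ n ^ p * star (diagD θ n) ^ q := by
      intro ω
      rw [starWord_replicate]
      rfl
    simp only [expectedTrace, h1, diagD_pow_mul_star_pow, Matrix.trace_diagonal]
    rw [integral_const, probReal_univ, one_smul, Finset.sum_range]
  · intro τ _ Ω _ P _ c ct hA w
    obtain ⟨K, hK⟩ := hA.exists_normalizedMoments
    have h1 : (Sum.elim (fun j => b (.inl j)) (Sum.elim (fun j => b (.inr (.inl j)))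
        fun _ : Unit => b (.inr (.inr ())))) = b := by
      funext x
      rcases x with r | r | u <;> rfl
    rw [h1]
    have h2 := hlim w
    simp only [hmean] at h2
    refine (tendsto_wordMean_of_tendsto (fun _ => hK₀) (fun _ => hK)
      (fun n => norm_twistPhase 0 n) (fun n => norm_twistPhase τ n) _
      (approximableSymbol_of_mem_map_letterOf θ w) h2).congr fun n => ?_
    exact (expectedTrace_starWord θ τ hA n w).symm
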